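/- **Setting.** Let a CSS code on $n$ qubits be given by finitely many $X$-stabilizers $X^{\otimes S}$ and $Z$-stabilizers $Z^{\otimes S}$ ($S\subseteq\{1,\dots,n\}$, every $X$-support meeting every $Z$-support in an even number of qubits), and let $V$ be an encoder, i.e. an isometry from $k$ qubits onto the joint $+1$ eigenspace of all stabilizers. The foliation circuit with $L$ rounds acts on $n$ code qubits that start in a code state, and has steps $t=1,\dots,2L$. In step $t$: (i) each code qubit $i$ is teleported to a fresh qubit $(i,t)$ prepared in $|+\rangle$, by a CZ gate followed by an $X$-basis measurement of the old qubit with outcome $m_{i,t}\in\{0,1\}$; (ii) each $X$-stabilizer ($t$ odd) or each $Z$-stabilizer ($t$ even) is measured with an ancilla prepared in $|+\rangle$, coupled by CZ gates, in any order, to the fresh qubits in the support of the stabilizer, and measured in the $X$ basis, with outcomes $\vec s_t$. A single-qubit channel $\mathcal N_{\gamma,w}$, $w=1,\dots,W_\gamma$, acts on each physical qubit $\gamma$ (a fresh code qubit $(i,t)$ or an ancilla of step $t$, $1\le t\le 2L$) after its preparation and after each of the $W_\gamma-1$ CZ gates acting on it; the initial code qubits carry no noise. At the end the Pauli frame $X^{m_{i,2}+m_{i,4}+\dots+m_{i,2L}}Z^{m_{i,1}+m_{i,3}+\dots+m_{i,2L-1}}$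 on each code qubit $i$ is undone, and a decoding and recovery channel $\mathcal R_\sigma$ from $n$ to $k$ qubits is applied, which depends on the outcomes only through the cluster-state stabilizer outcomes $\sigma=(\vec s_t+\vec s_{t-2}+\vec u_t)_{t}$ (mod 2), where $\vec u_t$ sums the $m_{i,t}$ over the support of each stabilizer and $\vec s_{-1}=\vec s_0=0$. Averaging over all measurement outcomes gives the average logical channel $\mathcal E_{\rm L}[\{\mathcal N_{\gamma,w}\}]$ on $k$ qubits. **Assumption.** Every $\mathcal N=\mathcal N_{\gamma,w}$ is a channel with pure $Z$-coherences: with $[\mathcal N]_{P,P'}=\tfrac12\mathrm{Tr}[P^\dagger\mathcal N(P')]$, one has $[\mathcal N]_{P,XP}=[\mathcal N]_{P,YP}=0$ for all $P\in\{I,X,Y,Z\}$ and $[\mathcal N]_{Z,Z}=1$. **Replacement.** Let $b_\gamma$ be the probability of $Z$ in the Pauli twirl of the composition $\mathcal N_{\gamma,W_\gamma}\circ\cdots\circ\mathcal N_{\gamma,1}$ (so $b_\gamma=|\beta|^2$ if this composition is $N\cdot N^\dagger$ with $N=\alpha I+\beta Z$). Put $\mathcal F_{\gamma,w}(\rho)=(1-p_{\gamma,w})\rho+p_{\gamma,w}Z\rho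 Z$ with $$p_{\gamma,w}=\tfrac12\Bigl(1-\sqrt[W_\gamma]{1-2b_\gamma}\Bigr),$$ the root being the real one. If $W_\gamma$ is even and $b_\gamma>\tfrac12$, where there is no real root, put $p_{\gamma,1}=\tfrac12(1+\sqrt[W_\gamma]{2b_\gamma-1})$ and $p_{\gamma,w}=\tfrac12(1-\sqrt[W_\gamma]{2b_\gamma-1})$ for $w\ge2$. **Claim.** All $p_{\gamma,w}$ lie in $[0,1]$, so that the $\mathcal F_{\gamma,w}$ are Pauli channels, and replacing the noise by them does not change the average logical channel: $$\mathcal E_{\rm L}[\{\mathcal N_{\gamma,w}\}]=\mathcal E_{\rm L}[\{\mathcal F_{\gamma,w}\}].$$ Hence the logical channel under the coherent noise is obtained exactly from Clifford circuits with random Pauli gates: $\mathcal E_{\rm L}[\{\mathcal N_{\gamma,w}\}]$ is the expectation of the average logical channel of the noiseless foliation circuit with a gate $Z^{e_{\gamma,w}}$ inserted at each location, where the bits $e_{\gamma,w}$ are independent and $e_{\gamma,w}=1$ has probability $p_{\gamma,w}$. -/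

import Mathlib

open scoped BigOperators Matrix

noncomputable section

namespace Foliation

/-! ### Qubits, Pauli operators, channels -/

/-- Classical bits; they also label the computational basis of a qubit. -/
abbrev Bit := ZMod 2

/-- Operators on the qubits labelled by `Q`, in the computational basis. -/
abbrev Op (Q : Type*) := Matrix (Q → Bit) (Q → Bit) ℂ

abbrev QubitOp := Matrix Bit Bit ℂ

/-- Linear maps on the operators of one qubit. -/
abbrev QubitMap := QubitOp →ₗ[ℂ] QubitOp

/-- `(-1)^b`. -/
def sgn (b : Bit) : ℂ := (-1) ^ b.val

def pauliX : QubitOp := Matrix.of fun a b => if a = b + 1 then 1 else 0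

def pauliZ : QubitOp := Matrix.diagonal sgn

def pauliY : QubitOp := Complex.I • (pauliX * pauliZ)

/-- `I, X, Y, Z`. -/
def pauli : Fin 4 → QubitOp := ![1, pauliX, pauliY, pauliZ]

/-- The map `ρ ↦ A ρ A†`. -/
def conjBy {α β : Type*} [Fintype α] (A : Matrix β α ℂ) :
    Matrix α α ℂ →ₗ[ℂ] Matrix β β ℂ where
  toFun ρ := A * ρ * Aᴴ
  map_add' ρ σ := by rw [Matrix.mul_add, Matrix.add_mul]
  map_smul' c ρ := by simp

/-- Quantum channels, in Kraus form. -/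
def IsChannel {α β : Type*} [Fintype α] [DecidableEq α] [Fintype β]
    (Φ : Matrix α α ℂ →ₗ[ℂ] Matrix β β ℂ) : Prop :=
  ∃ (d : ℕ) (K : Fin d → Matrix β α ℂ),
    ∑ j, (K j)ᴴ * K j = 1 ∧ ∀ ρ, Φ ρ = ∑ j, K j * ρ * (K j)ᴴ

/-- `Φ(ρ) = ∑ p_E E ρ E†` over `E = I, X, Y, Z`, with `p` a probability vector. -/
def IsPauliChannel (Φ : QubitMap) : Prop :=
  ∃ p : Fin 4 → ℝ, (∀ j, 0 ≤ p j) ∧ ∑ j, p j = 1 ∧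
    ∀ ρ, Φ ρ = ∑ j, (p j : ℂ) • (pauli j * ρ * (pauli j)ᴴ)

/-- Entry `[Φ]_{P,P'} = Tr[P† Φ(P')] / 2` of the Pauli transfer matrix. -/
def ptm (Φ : QubitMap) (P P' : QubitOp) : ℂ := (Pᴴ * Φ P').trace / 2

/-- A single-qubit channel with pure `Z`-coherences. -/
structure IsPureZCoherent (Φ : QubitMap) : Prop where
  channel : IsChannel Φ
  no_x : ∀ j, ptm Φ (pauli j) (pauliX * pauli j) = 0
  no_y : ∀ j, ptm Φ (pauli j) (pauliY * pauli j) = 0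
  zz : ptm Φ pauliZ pauliZ = 1

/-- The channel `ρ ↦ (1 - p) ρ + p Z ρ Z`. -/
def phaseFlip (p : ℝ) : QubitMap :=
  ((1 - p : ℝ) : ℂ) • LinearMap.id + (p : ℂ) • conjBy pauliZ

/-- Tensor product of single-qubit operators. -/
def tensor {Q : Type*} [Fintype Q] (A : Q → QubitOp) : Op Q :=
  Matrix.of fun z z' => ∏ q, A q (z q) (z' q)

/-- `Φ` on qubit `q` and the identity on all other qubits. -/
def applyAt {Q : Type*} [DecidableEq Q] (q : Q) (Φ : QubitMap) (ρ : Op Q) : Op Q :=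
  Matrix.of fun z z' =>
    Φ (Matrix.of fun a b => ρ (Function.update z q a) (Function.update z' q b)) (z q) (z' q)

/-- The controlled-`Z` gate. -/
def czGate {Q : Type*} [Fintype Q] [DecidableEq Q] (a b : Q) : Op Q :=
  Matrix.diagonal fun z => sgn (z a * z b)

/-! ### Circuits of CZ gates and single-qubit noise -/

inductive Instr (Q : Type) where
  | cz (a b : Q)
  | noise (q : Q) (Φ : QubitMap)

def Instr.apply {Q : Type} [Fintype Q] [DecidableEq Q] : Instr Q → Op Q → Op Q
  | .cz a b, ρ => conjBy (czGate a b) ρ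
  | .noise q Φ, ρ => applyAt q Φ ρ

/-- Run the instructions from left to right. -/
def runInstrs {Q : Type} [Fintype Q] [DecidableEq Q] (c : List (Instr Q)) (ρ : Op Q) : Op Q :=
  c.foldl (fun ρ g => g.apply ρ) ρ

/-- Adjoin qubits `B`, each prepared in the state `|+⟩`. -/
def attachPlus {A B : Type} [Fintype B] (ρ : Op A) : Op (A ⊕ B) :=
  Matrix.of fun z z' => ρ (z ∘ Sum.inl) (z' ∘ Sum.inl) *
    tensor (fun _ : B => Matrix.of fun _ _ => 1 / 2) (z ∘ Sum.inr) (z' ∘ Sum.inr)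

/-- The amplitude `⟨+|z⟩` (for `m = 0`) or `⟨-|z⟩` (for `m = 1`). -/
def xBra (m z : Bit) : ℂ := sgn (m * z) / (Real.sqrt 2 : ℂ)

/-- The Kraus operator of measuring the qubits `A` and `B` in the `X` basis with outcomes `m`
and `s` and discarding them; the qubits `F` are kept. -/
def measKraus {A F B : Type} [Fintype A] [Fintype F] [Fintype B] (m : A → Bit) (s : B → Bit) :
    Matrix (F → Bit) ((A ⊕ (F ⊕ B)) → Bit) ℂ :=
  Matrix.of fun y z =>
    if (fun i => z (Sum.inr (Sum.inl i))) = y then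
      (∏ i, xBra (m i) (z (Sum.inl i))) * ∏ p, xBra (s p) (z (Sum.inr (Sum.inr p)))
    else 0

/-! ### CSS codes -/

inductive Kind where
  | X
  | Z
  deriving DecidableEq

instance : Fintype Kind := ⟨{Kind.X, Kind.Z}, fun κ => by cases κ <;> simp⟩

def Kind.pauli : Kind → QubitOp
  | .X => pauliX
  | .Z => pauliZ

/-- A CSS code on `n` qubits given by the supports of its `X` and `Z` stabilizers. -/
structure CSSCode (n : ℕ) where
  num : Kind → ℕ
  supp : (κ : Kind) → Fin (num κ) → Finset (Fin n)
  even_inter : ∀ p q, Even (supp .X p ∩ supp .Z q).card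

namespace CSSCode

variable {n : ℕ} (C : CSSCode n)

/-- The stabilizer generator `X^{⊗S}` or `Z^{⊗S}`. -/
def stab (κ : Kind) (p : Fin (C.num κ)) : Op (Fin n) :=
  tensor fun i => if i ∈ C.supp κ p then κ.pauli else 1

/-- `V` is an isometry from `k` qubits onto the joint `+1` eigenspace of the stabilizers. -/
def IsEncoder {k : ℕ} (V : Matrix (Fin n → Bit) (Fin k → Bit) ℂ) : Prop :=
  Vᴴ * V = 1 ∧
    ∀ ψ : (Fin n → Bit) → ℂ, (∃ φ, V *ᵥ φ = ψ) ↔ ∀ κ p, C.stab κ p *ᵥ ψ = ψ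

/-! ### The foliation circuit

The time steps `t = 1, …, 2L` are written as pairs `(r, κ)` with `r < L`: step `t = 2r + 1` is
`(r, X)` and step `t = 2r + 2` is `(r, Z)`. In step `(r, κ)` every code qubit is teleported onto a
fresh qubit and the stabilizers of kind `κ` are measured through ancillas. -/

/-- The order in which the CZ gates between ancillas and code qubits are executed in each step. -/
structure Schedule (L : ℕ) where
  gates : Fin L → (κ : Kind) → List (Fin (C.num κ) × Fin n)
  nodup : ∀ r κ, (gates r κ).Nodup
  mem_iff : ∀ r κ p i, (p, i) ∈ gates r κ ↔ i ∈ C.supp κ p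

/-- The physical qubits that suffer noise: `inl (r, κ, i)` is the qubit onto which code qubit `i`
is teleported in step `(r, κ)`, and `inr (r, ⟨κ, p⟩)` is the ancilla measuring stabilizer `p` of
kind `κ` in step `(r, κ)`. -/
abbrev PhysQubit (L : ℕ) := (Fin L × Kind × Fin n) ⊕ (Fin L × Σ κ : Kind, Fin (C.num κ))

/-- The number of noise locations on a physical qubit: one after its preparation and one after
each CZ gate acting on it (teleportation onto it, stabilizer measurements, and, except for the
output qubits, teleportation to the next qubit). -/
def numLoc {L : ℕ} : C.PhysQubit L → ℕ
  | .inl (r, κ, i) =>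
      2 + (Finset.univ.filter fun p => i ∈ C.supp κ p).card +
        (if κ = Kind.Z ∧ r.val + 1 = L then 0 else 1)
  | .inr (_, ⟨κ, p⟩) => 1 + (C.supp κ p).card

/-- A noise map for each physical qubit `γ` and location `w` on it. Only the locations
`w < C.numLoc γ` occur in the circuit. -/
abbrev Noise (L : ℕ) := C.PhysQubit L → ℕ → QubitMap

/-- The qubits present during a step: the old code qubits, the fresh ones, the ancillas. -/
abbrev Reg (κ : Kind) := Fin n ⊕ (Fin n ⊕ Fin (C.num κ))

variable {C} {L : ℕ}

/-- The last noise location of the code qubit that enters step `(r, κ)`, after its CZ gate with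
the fresh qubit. The input qubits of the whole circuit carry no noise. -/
def lastNoise (N : C.Noise L) (r : Fin L) : Kind → Fin n → QubitMap
  | .Z, i => N (.inl (r, .X, i)) (C.numLoc (L := L) (.inl (r, .X, i)) - 1)
  | .X, i =>
      if 0 < r.val then
        let r' : Fin L := ⟨r.val - 1, lt_of_le_of_lt (Nat.sub_le _ _) r.isLt⟩
        N (.inl (r', .Z, i)) (C.numLoc (L := L) (.inl (r', .Z, i)) - 1)
      else LinearMap.id

/-- Noise after the preparation of the fresh qubits and ancillas. -/
def prepInstrs (N : C.Noise L) (r : Fin L) (κ : Kind) : List (Instr (C.Reg κ)) :=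
  ((List.finRange n).map fun i =>
      Instr.noise (Sum.inr (Sum.inl i)) (N (.inl (r, κ, i)) 0)) ++
  ((List.finRange (C.num κ)).map fun p =>
      Instr.noise (Sum.inr (Sum.inr p)) (N (.inr (r, ⟨κ, p⟩)) 0))

/-- The CZ gates of the teleportations, each followed by noise on both qubits. -/
def teleInstrs (N : C.Noise L) (r : Fin L) (κ : Kind) : List (Instr (C.Reg κ)) :=
  (List.finRange n).flatMap fun i =>
    [Instr.cz (Sum.inl i) (Sum.inr (Sum.inl i)),
     Instr.noise (Sum.inl i) (lastNoise N r κ i),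
     Instr.noise (Sum.inr (Sum.inl i)) (N (.inl (r, κ, i)) 1)]

/-- The CZ gates of the stabilizer measurements, each followed by noise on both qubits. The first
list holds the gates already executed, and is used to number the noise locations. -/
def checkInstrs (N : C.Noise L) (r : Fin L) (κ : Kind) :
    List (Fin (C.num κ) × Fin n) → List (Fin (C.num κ) × Fin n) → List (Instr (C.Reg κ))
  | _, [] => []
  | done, (p, i) :: todo =>
      Instr.cz (Sum.inr (Sum.inr p)) (Sum.inr (Sum.inl i)) ::
      Instr.noise (Sum.inr (Sum.inr p))
        (N (.inr (r, ⟨κ, p⟩)) (1 + done.countP fun g => g.1 = p)) ::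
      Instr.noise (Sum.inr (Sum.inl i))
        (N (.inl (r, κ, i)) (2 + done.countP fun g => g.2 = i)) ::
      checkInstrs N r κ ((p, i) :: done) todo

/-- All gates and noise of step `(r, κ)` between the preparations and the measurements. -/
def stepInstrs (sch : C.Schedule L) (N : C.Noise L) (r : Fin L) (κ : Kind) :
    List (Instr (C.Reg κ)) :=
  prepInstrs N r κ ++ teleInstrs N r κ ++ checkInstrs N r κ [] (sch.gates r κ)

/-- The unnormalized effect of step `(r, κ)` on the code qubits, given the teleportation outcomes
`m` and the stabilizer outcomes `s`. -/
def step (sch : C.Schedule L) (N : C.Noise L) (r : Fin L) (κ : Kind)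
    (m : Fin n → Bit) (s : Fin (C.num κ) → Bit) (ρ : Op (Fin n)) : Op (Fin n) :=
  conjBy (measKraus m s)
    (runInstrs (stepInstrs sch N r κ) (attachPlus (B := Fin n ⊕ Fin (C.num κ)) ρ))

variable (C L) in
/-- The outcomes `(m, s)` of all teleportations and stabilizer measurements. -/
abbrev Outcome := Fin L → (κ : Kind) → (Fin n → Bit) × (Fin (C.num κ) → Bit)

variable (C L) in
/-- One bit for each stabilizer measurement. -/
abbrev Syndrome := Fin L → (κ : Kind) → Fin (C.num κ) → Bit

/-- The unnormalized state after all `2L` steps, given all outcomes. -/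
def branch (sch : C.Schedule L) (N : C.Noise L) (o : C.Outcome L) (ρ : Op (Fin n)) :
    Op (Fin n) :=
  (List.finRange L).foldl
    (fun ρ r => step sch N r .Z (o r .Z).1 (o r .Z).2 (step sch N r .X (o r .X).1 (o r .X).2 ρ)) ρ

/-- The cluster state stabilizer outcomes `s_t + s_{t-2} + u_t(m_t)`, where `u_t` sums the
teleportation outcomes over the support of the stabilizer and `s_{-1} = s_0 = 0`. -/
def syndrome (o : C.Outcome L) : C.Syndrome L := fun r κ p =>
  (o r κ).2 p +
  (if 0 < r.val then
    (o ⟨r.val - 1, lt_of_le_of_lt (Nat.sub_le _ _) r.isLt⟩ κ).2 p else 0) +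
  ∑ i ∈ C.supp κ p, (o r κ).1 i

/-- The Pauli frame `X^{m_2 + m_4 + ⋯ + m_{2L}} Z^{m_1 + m_3 + ⋯ + m_{2L-1}}` on each code
qubit. -/
def frame (o : C.Outcome L) : Op (Fin n) :=
  tensor fun i =>
    pauliX ^ (∑ r, (o r .Z).1 i).val * pauliZ ^ (∑ r, (o r .X).1 i).val

/-- The average logical channel: encode, run the noisy foliation circuit, undo the Pauli frame,
apply the decoding and recovery operation `R σ` chosen from the cluster state stabilizer outcomes
`σ`, and sum over all measurement outcomes (the branches carry their probabilities). -/
def logicalChannel {k : ℕ} (sch : C.Schedule L) (V : Matrix (Fin n → Bit) (Fin k → Bit) ℂ)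
    (R : C.Syndrome L → Op (Fin n) →ₗ[ℂ] Op (Fin k)) (N : C.Noise L)
    (ρ : Op (Fin k)) : Op (Fin k) :=
  ∑ o : C.Outcome L,
    R (syndrome o) (conjBy (frame o)ᴴ (branch sch N o (conjBy V ρ)))

/-! ### The Pauli channels replacing the coherent noise -/

/-- The composition of all noise maps on a physical qubit, in temporal order. -/
def lumped (N : C.Noise L) (γ : C.PhysQubit L) : QubitMap :=
  (List.range (C.numLoc γ)).foldl (fun Ψ w => N γ w ∘ₗ Ψ) LinearMap.id

/-- The weight of `Z · Z` in `Φ`, that is, the `Z` probability of its Pauli twirl. For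
`Φ = ∑ c_k N_k · N_k†` with `N_k = α_k I + β_k Z` this is `∑ c_k |β_k|²`. -/
def zWeight (Φ : QubitMap) : ℝ :=
  ((ptm Φ 1 1 - ptm Φ pauliX pauliX - ptm Φ pauliY pauliY + ptm Φ pauliZ pauliZ) / 4).re

/-- Real numbers indexed by `w < W` with product `x`: each is the real `W`-th root of `x` if there
is one. If `x < 0` and `W` is even, they are the `W`-th root of `|x|` with the sign of one of them
changed. -/
def splitRoot (x : ℝ) (W w : ℕ) : ℝ :=
  if 0 ≤ x then x ^ (1 / W : ℝ)
  else if Odd W ∨ w = 0 then -((-x) ^ (1 / W : ℝ))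
  else (-x) ^ (1 / W : ℝ)

/-- The phase flip probability at location `w` on `γ`: `(1 - (1 - 2|β_γ|²)^{1/W}) / 2`. -/
def flipProb (N : C.Noise L) (γ : C.PhysQubit L) (w : ℕ) : ℝ :=
  (1 - splitRoot (1 - 2 * zWeight (lumped N γ)) (C.numLoc γ) w) / 2

/-- The Pauli channels replacing the noise maps. -/
def pauliReplacement (N : C.Noise L) : C.Noise L := fun γ w => phaseFlip (flipProb N γ w)

variable (C L) in
/-- A choice of Pauli gate `Z^e` at each noise location. -/
abbrev ErrorConfig := (γ : C.PhysQubit L) → Fin (C.numLoc γ) → Bit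

/-- The foliation circuit in which the noise is the fixed Pauli gate `Z^e` at each location. -/
def insertPaulis (e : C.ErrorConfig L) : C.Noise L := fun γ w =>
  if h : w < C.numLoc γ then conjBy (pauliZ ^ (e γ ⟨w, h⟩).val) else LinearMap.id

/-- The probability of `e` when each location independently has `Z` with probability
`flipProb`. -/
def configProb (N : C.Noise L) (e : C.ErrorConfig L) : ℝ :=
  ∏ γ, ∏ w : Fin (C.numLoc γ),
    if e γ w = 1 then flipProb N γ w else 1 - flipProb N γ w

end CSSCode

end Foliation

end

noncomputable section

namespace Foliation

open CSSCode

/-! ### Signs -/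

/-! Trace preservation together with `[N]_{Z,Z} = 1` forces every Kraus operator of the noise to be
diagonal (`IsPureZCoherent.exists_diagonal_kraus`). Such noise multiplies each matrix entry by a
scalar, hence commutes with the CZ gates. All noise on one physical qubit therefore merges into a
single map with coefficients c(a,b), where c(0,0) = c(1,1) = 1 and c(1,0) is the conjugate of c(0,1)
(`branch_eq_foldl_lumpedRound`).

Expanding each merged map in the terms ρ ↦ Z^g ρ Z^g' gives a double sum over error patterns E on
the left and E' on the right of the state. For fixed outcomes and errors, a step is a Hadamard
transform followed by Pauli operators and a parity projection (`errKraus_eq`), so a code state only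
acquires a Pauli operator and a scalar. Once the Pauli frame is undone, the remaining Pauli operator
depends on the errors but not on the outcomes, and the amplitude is either zero or a sign times a
fixed constant (`frame_mul_circuitKraus`, `amplitude_eq`).

The heart is `sum_amplitude_eq_zero`: the terms with E ≠ E' cancel in the sum over outcomes, because
the recovery sees only the syndrome. If E and E' differ on a fresh qubit, some flip of teleportation
outcomes, compensated by flips of stabilizer outcomes so that the syndrome is unchanged, reverses
their relative sign. If they differ only on ancillas, no outcomes are compatible with both.

Hence the logical channel depends on the noise only through the diagonal weights (1 ± Re c(0,1))/2
of each physical qubit (`logicalChannel_eq_sum`), where Re c(0,1) = 1 - 2b. Phase flips multiply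
coherences by 1 - 2p, and the chosen p make the product of these factors equal to 1 - 2b; since |1 -
2b| ≤ 1, they are probabilities. The weights are linear in the coefficients, so averaging over
independent random Z gates gives the same channel. -/

theorem bit_cases (a : Bit) : a = 0 ∨ a = 1 := by
  revert a; decide

@[simp] theorem sgn_zero : sgn 0 = 1 := by simp [sgn]

@[simp] theorem sgn_one : sgn 1 = -1 := by simp [sgn, ZMod.val_one]

theorem bit_add_self (a : Bit) : a + a = 0 := CharTwo.add_self_eq_zero a

theorem sgn_add (a b : Bit) : sgn (a + b) = sgn a * sgn b := by
  rcases bit_cases a with rfl | rfl <;> rcases bit_cases b with rfl | rfl <;>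
    simp [bit_add_self]

@[simp] theorem sgn_mul_self (a : Bit) : sgn a * sgn a = 1 := by
  rw [← sgn_add, bit_add_self, sgn_zero]

@[simp] theorem star_sgn (a : Bit) : star (sgn a) = sgn a := by
  rcases bit_cases a with rfl | rfl <;> simp

theorem sgn_sum {ι : Type*} (s : Finset ι) (f : ι → Bit) :
    sgn (∑ i ∈ s, f i) = ∏ i ∈ s, sgn (f i) := by
  classical
  induction s using Finset.induction_on with
  | empty => simp
  | insert a s ha ih => rw [Finset.sum_insert ha, Finset.prod_insert ha, sgn_add, ih]

theorem sgn_dotProduct {ι : Type*} [Fintype ι] (f g : ι → Bit) :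
    sgn (f ⬝ᵥ g) = ∏ i, sgn (f i * g i) := sgn_sum _ _

theorem sum_bit {M : Type*} [AddCommMonoid M] (f : Bit → M) : ∑ b, f b = f 0 + f 1 :=
  Fin.sum_univ_two f

/-! ### Schur multipliers -/

/-- The coefficients of `Φ`, when it acts by entrywise multiplication. -/
def schurCoeff (Φ : QubitMap) (a b : Bit) : ℂ := Φ (Matrix.of fun _ _ => 1) a b

/-- `Φ` acts by entrywise multiplication in the computational basis. -/
def IsSchur (Φ : QubitMap) : Prop := ∀ ρ a b, Φ ρ a b = schurCoeff Φ a b * ρ a b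

theorem schurCoeff_eq {Φ : QubitMap} {c : Bit → Bit → ℂ} (h : ∀ ρ a b, Φ ρ a b = c a b * ρ a b)
    (a b : Bit) : schurCoeff Φ a b = c a b := by
  simp [schurCoeff, h]

theorem isSchur_of_forall {Φ : QubitMap} {c : Bit → Bit → ℂ}
    (h : ∀ ρ a b, Φ ρ a b = c a b * ρ a b) : IsSchur Φ := fun ρ a b => by
  rw [schurCoeff_eq h, h]

theorem isSchur_id : IsSchur LinearMap.id := by
  intro ρ a b; simp [schurCoeff]

@[simp] theorem schurCoeff_id (a b : Bit) : schurCoeff LinearMap.id a b = 1 := by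
  simp [schurCoeff]

theorem IsSchur.comp {Φ Ψ : QubitMap} (hΦ : IsSchur Φ) (hΨ : IsSchur Ψ) :
    IsSchur (Φ ∘ₗ Ψ) ∧
      ∀ a b, schurCoeff (Φ ∘ₗ Ψ) a b = schurCoeff Φ a b * schurCoeff Ψ a b := by
  have h : ∀ ρ a b, (Φ ∘ₗ Ψ) ρ a b = (schurCoeff Φ a b * schurCoeff Ψ a b) * ρ a b := by
    intro ρ a b
    rw [LinearMap.comp_apply, hΦ, hΨ, mul_assoc]
  exact ⟨isSchur_of_forall h, schurCoeff_eq h⟩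

theorem conjBy_diagonal_apply {α : Type*} [Fintype α] [DecidableEq α] (d : α → ℂ)
    (ρ : Matrix α α ℂ) (a b : α) :
    conjBy (Matrix.diagonal d) ρ a b = d a * star (d b) * ρ a b := by
  simp only [conjBy, LinearMap.coe_mk, AddHom.coe_mk, Matrix.diagonal_conjTranspose,
    Matrix.mul_diagonal, Matrix.diagonal_mul, Pi.star_apply]
  ring

theorem conjBy_pauliZ_pow_apply (g : Bit) (ρ : QubitOp) (a b : Bit) :
    conjBy (pauliZ ^ g.val) ρ a b = sgn (g * (a + b)) * ρ a b := by
  rw [pauliZ, Matrix.diagonal_pow, conjBy_diagonal_apply]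
  rcases bit_cases g with rfl | rfl
  · simp
  · simp [ZMod.val_one, sgn_add]

theorem phaseFlip_apply (p : ℝ) (ρ : QubitOp) (a b : Bit) :
    phaseFlip p ρ a b = ((1 - p : ℝ) + p * sgn (a + b)) * ρ a b := by
  have h := conjBy_pauliZ_pow_apply 1 ρ a b
  simp only [ZMod.val_one, pow_one, one_mul] at h
  simp only [phaseFlip, LinearMap.add_apply, LinearMap.smul_apply, LinearMap.id_apply,
    Matrix.add_apply, Matrix.smul_apply, h, smul_eq_mul]
  ring

/-! ### Channels with pure `Z`-coherences -/

theorem pauliX_apply (a b : Bit) : pauliX a b = if a = b + 1 then 1 else 0 := rfl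

theorem pauliZ_apply (a b : Bit) : pauliZ a b = if a = b then sgn a else 0 := by
  simp [pauliZ, Matrix.diagonal_apply]

theorem pauliY_apply (a b : Bit) :
    pauliY a b = if a = b + 1 then Complex.I * sgn b else 0 := by
  simp [pauliY, pauliZ, Matrix.mul_diagonal, pauliX_apply]

theorem trace_conj_pauliZ (K : QubitOp) :
    (pauliZᴴ * (K * pauliZ * Kᴴ)).trace =
      ((Complex.normSq (K 0 0) - Complex.normSq (K 0 1) - Complex.normSq (K 1 0) +
        Complex.normSq (K 1 1) : ℝ) : ℂ) := by
  have h : (pauliZᴴ * (K * pauliZ * Kᴴ)).trace =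
      ∑ a, sgn a * ∑ b, K a b * sgn b * star (K a b) := by
    simp only [pauliZ, Matrix.diagonal_conjTranspose, Matrix.trace, Matrix.diag_apply,
      Matrix.diagonal_mul, Pi.star_apply, star_sgn]
    refine Finset.sum_congr rfl fun a _ => congrArg _ ?_
    rw [Matrix.mul_apply]
    simp only [Matrix.mul_diagonal, Matrix.conjTranspose_apply]
  rw [h]
  simp only [sum_bit, sgn_zero, sgn_one, Complex.ofReal_add, Complex.ofReal_sub,
    Complex.normSq_eq_conj_mul_self, Complex.star_def]
  ring

theorem conjTranspose_mul_self_apply (K : QubitOp) (a : Bit) :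
    (Kᴴ * K) a a = ((Complex.normSq (K 0 a) + Complex.normSq (K 1 a) : ℝ) : ℂ) := by
  simp only [Matrix.mul_apply, sum_bit, Matrix.conjTranspose_apply, Complex.ofReal_add,
    Complex.normSq_eq_conj_mul_self, Complex.star_def]

/-- Trace preservation makes the squared moduli of all Kraus entries sum to 2. The condition on the
`Z`, `Z` entry says that the diagonal ones minus the off-diagonal ones also sum to 2, so the
off-diagonal ones vanish. -/
theorem IsPureZCoherent.exists_diagonal_kraus {Φ : QubitMap} (h : IsPureZCoherent Φ) :
    ∃ (d : ℕ) (k : Fin d → Bit → ℂ), (∀ a, ∑ j, Complex.normSq (k j a) = 1) ∧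
      ∀ ρ a b, Φ ρ a b = (∑ j, k j a * star (k j b)) * ρ a b := by
  obtain ⟨d, K, hK, hΦ⟩ := h.channel
  have hcol : ∀ a, ∑ j, (Complex.normSq (K j 0 a) + Complex.normSq (K j 1 a)) = 1 := by
    intro a
    have h1 := congrFun (congrFun hK a) a
    simp only [Matrix.sum_apply, conjTranspose_mul_self_apply, Matrix.one_apply_eq] at h1
    exact_mod_cast h1
  have hz := h.zz
  rw [ptm, hΦ, Matrix.mul_sum, Matrix.trace_sum] at hz
  simp only [trace_conj_pauliZ] at hz
  have hz' : ∑ j, (Complex.normSq (K j 0 0) - Complex.normSq (K j 0 1) -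
      Complex.normSq (K j 1 0) + Complex.normSq (K j 1 1)) = 2 := by
    rw [div_eq_iff two_ne_zero, one_mul] at hz
    exact_mod_cast hz
  have hoff : ∑ j, (Complex.normSq (K j 0 1) + Complex.normSq (K j 1 0)) = 0 := by
    have h0 := hcol 0
    have h1 := hcol 1
    simp only [Finset.sum_add_distrib, Finset.sum_sub_distrib] at h0 h1 hz' ⊢
    linarith
  rw [Finset.sum_eq_zero_iff_of_nonneg
    fun j _ => add_nonneg (Complex.normSq_nonneg _) (Complex.normSq_nonneg _)] at hoff
  have hoff' : ∀ j a b, a ≠ b → K j a b = 0 := by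
    intro j a b hab
    have := hoff j (Finset.mem_univ _)
    have h01 := Complex.normSq_nonneg (K j 0 1)
    have h10 := Complex.normSq_nonneg (K j 1 0)
    rw [← Complex.normSq_eq_zero]
    rcases bit_cases a with rfl | rfl <;> rcases bit_cases b with rfl | rfl
    · exact absurd rfl hab
    · linarith
    · linarith
    · exact absurd rfl hab
  have hdiag : ∀ j, K j = Matrix.diagonal fun a => K j a a := by
    intro j
    ext a b
    by_cases hab : a = b
    · subst hab; simp
    · rw [Matrix.diagonal_apply_ne _ hab, hoff' j a b hab]
  refine ⟨d, fun j a => K j a a, fun a => ?_, fun ρ a b => ?_⟩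
  · rw [← hcol a]
    refine Finset.sum_congr rfl fun j _ => ?_
    rcases bit_cases a with rfl | rfl
    · simp [hoff' j 1 0 one_ne_zero]
    · simp [hoff' j 0 1 zero_ne_one]
  · rw [hΦ, Matrix.sum_apply, Finset.sum_mul]
    refine Finset.sum_congr rfl fun j _ => ?_
    conv_lhs => rw [hdiag j]
    exact conjBy_diagonal_apply (fun a => K j a a) ρ a b

theorem IsPureZCoherent.isSchur {Φ : QubitMap} (h : IsPureZCoherent Φ) : IsSchur Φ := by
  obtain ⟨d, k, -, hΦ⟩ := h.exists_diagonal_kraus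
  exact isSchur_of_forall hΦ

theorem IsPureZCoherent.schurCoeff_self {Φ : QubitMap} (h : IsPureZCoherent Φ) (a : Bit) :
    schurCoeff Φ a a = 1 := by
  obtain ⟨d, k, hk, hΦ⟩ := h.exists_diagonal_kraus
  rw [schurCoeff_eq hΦ, ← Complex.ofReal_one, ← hk a, Complex.ofReal_sum]
  exact Finset.sum_congr rfl fun j _ => Complex.mul_conj _

theorem IsPureZCoherent.schurCoeff_symm {Φ : QubitMap} (h : IsPureZCoherent Φ) (a b : Bit) :
    schurCoeff Φ b a = star (schurCoeff Φ a b) := by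
  obtain ⟨d, k, -, hΦ⟩ := h.exists_diagonal_kraus
  simp only [schurCoeff_eq hΦ, star_sum, star_mul', star_star]
  exact Finset.sum_congr rfl fun j _ => mul_comm _ _

/-- Each term is bounded by the inequality between geometric and arithmetic means, and the columns
of the Kraus family are normalized. -/
theorem IsPureZCoherent.norm_schurCoeff_le {Φ : QubitMap} (h : IsPureZCoherent Φ) (a b : Bit) :
    ‖schurCoeff Φ a b‖ ≤ 1 := by
  obtain ⟨d, k, hk, hΦ⟩ := h.exists_diagonal_kraus
  rw [schurCoeff_eq hΦ]
  calc ‖∑ j, k j a * star (k j b)‖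
      ≤ ∑ j, (Complex.normSq (k j a) + Complex.normSq (k j b)) / 2 := by
        refine norm_sum_le_of_le _ fun j _ => ?_
        rw [norm_mul, norm_star, Complex.normSq_eq_norm_sq, Complex.normSq_eq_norm_sq]
        nlinarith [sq_nonneg (‖k j a‖ - ‖k j b‖)]
    _ = 1 := by rw [← Finset.sum_div, Finset.sum_add_distrib, hk, hk]; norm_num

/-! ### Pauli weights -/

/-- The coefficient of `ρ ↦ Z^g ρ Z^g'` in the entrywise multiplication by `c`. -/
def chi (c : Bit → Bit → ℂ) (g g' : Bit) : ℂ :=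
  (∑ a, ∑ b, sgn (g * a) * sgn (g' * b) * c a b) / 4

/-- Fourier inversion on pairs of bits. -/
theorem sum_chi (c : Bit → Bit → ℂ) (a b : Bit) :
    ∑ g, ∑ g', chi c g g' * (sgn (g * a) * sgn (g' * b)) = c a b := by
  rcases bit_cases a with rfl | rfl <;> rcases bit_cases b with rfl | rfl <;>
    simp [chi, sum_bit] <;> ring

theorem chi_self (c : Bit → Bit → ℂ) (g : Bit) :
    chi c g g = (c 0 0 + c 1 1 + sgn g * (c 0 1 + c 1 0)) / 4 := by
  rcases bit_cases g with rfl | rfl <;> simp [chi, sum_bit] <;> ring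

/-- In the Pauli average the `I` and `Z` entries contribute the coefficients of the populations and
the `X` and `Y` entries those of the coherences, which leaves (c(0,0) + c(1,1) - c(0,1) - c(1,0))/4.
-/
theorem zWeight_eq {Φ : QubitMap} (h : IsSchur Φ) :
    zWeight Φ = (chi (schurCoeff Φ) 1 1).re := by
  rw [zWeight, chi_self]
  congr 1
  have e : ∀ P P' : QubitOp, ptm Φ P P' =
      (∑ a, ∑ b, star (P b a) * (schurCoeff Φ b a * P' b a)) / 2 := by
    intro P P'
    simp only [ptm, Matrix.trace, Matrix.diag_apply, Matrix.mul_apply, Matrix.conjTranspose_apply,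
      h P']
  have h2 : (1 : Bit) + 1 = 0 := bit_add_self 1
  simp only [e, sum_bit, pauliX_apply, pauliY_apply, pauliZ_apply, Matrix.one_apply, h2, zero_add]
  simp
  ring_nf
  simp
  ring

theorem prod_splitRoot (x : ℝ) {W : ℕ} (hW : W ≠ 0) :
    ∏ w ∈ Finset.range W, splitRoot x W w = x := by
  have hr : ∀ y : ℝ, 0 ≤ y → (y ^ (1 / W : ℝ)) ^ W = y := fun y hy => by
    rw [one_div]; exact Real.rpow_inv_natCast_pow hy hW
  by_cases hx : 0 ≤ x
  · simp [splitRoot, hx, Finset.prod_const, Finset.card_range, -one_div, hr x hx]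
  · have hx' : 0 ≤ -x := by linarith
    by_cases ho : Odd W
    · simp [splitRoot, hx, ho, Finset.prod_const, Finset.card_range, -one_div, ho.neg_pow, hr _ hx']
    · obtain ⟨W, rfl⟩ := Nat.exists_eq_succ_of_ne_zero hW
      -- For even `W` and negative `x` the single reversed sign sits at `w = 0`, so that factor is
      -- split off.
      rw [Finset.prod_range_succ']
      simp only [splitRoot, hx, ho, if_false, false_or, Nat.succ_ne_zero, Finset.prod_const,
        Finset.card_range, if_true, mul_neg]
      rw [← pow_succ, hr _ hx', neg_neg]

theorem abs_splitRoot_le (x : ℝ) (hx : |x| ≤ 1) (W w : ℕ) : |splitRoot x W w| ≤ 1 := by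
  have h : ∀ y : ℝ, 0 ≤ y → y ≤ 1 → |y ^ (1 / W : ℝ)| ≤ 1 := fun y h0 h1 => by
    rw [abs_of_nonneg (Real.rpow_nonneg h0 _)]
    exact Real.rpow_le_one h0 h1 (by positivity)
  obtain ⟨h1, h2⟩ := abs_le.mp hx
  unfold splitRoot
  split_ifs with h0
  · exact h x h0 h2
  · rw [abs_neg]; exact h _ (by linarith) (by linarith)
  · exact h _ (by linarith) (by linarith)

theorem isPauliChannel_phaseFlip {p : ℝ} (hp : p ∈ Set.Icc (0 : ℝ) 1) :
    IsPauliChannel (phaseFlip p) := by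
  refine ⟨![1 - p, 0, 0, p], fun j => ?_, ?_, fun ρ => ?_⟩
  · fin_cases j <;> simp [hp.1, hp.2]
  · simp [Fin.sum_univ_four]
  · ext a b
    simp [Fin.sum_univ_four, phaseFlip, pauli, conjBy]

/-! ### Circuits of diagonal instructions -/

/-- The factor by which a diagonal instruction multiplies the entry `(z, z')`. -/
def Instr.factor {Q : Type} (z z' : Q → Bit) : Instr Q → ℂ
  | .cz a b => sgn (z a * z b) * sgn (z' a * z' b)
  | .noise q Φ => schurCoeff Φ (z q) (z' q)

theorem Instr.factor_cz {Q : Type} (z z' : Q → Bit) (a b : Q) :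
    (Instr.cz a b).factor z z' = sgn (z a * z b) * sgn (z' a * z' b) := rfl

theorem Instr.factor_noise {Q : Type} (z z' : Q → Bit) (q : Q) (Φ : QubitMap) :
    (Instr.noise q Φ).factor z z' = schurCoeff Φ (z q) (z' q) := rfl

/-- CZ gates and noise that multiplies entrywise. -/
def Instr.IsDiagonal {Q : Type} : Instr Q → Prop
  | .cz _ _ => True
  | .noise _ Φ => IsSchur Φ

theorem Instr.apply_apply {Q : Type} [Fintype Q] [DecidableEq Q] {g : Instr Q}
    (hg : g.IsDiagonal) (ρ : Op Q) (z z' : Q → Bit) :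
    g.apply ρ z z' = g.factor z z' * ρ z z' := by
  cases g with
  | cz a b => simp [Instr.apply, czGate, conjBy_diagonal_apply, Instr.factor]
  | noise q Φ =>
    have h : IsSchur Φ := hg
    simp only [Instr.apply, applyAt, Instr.factor, Matrix.of_apply]
    -- Entrywise multiplication needs only the entry whose bits at `q` are unchanged, so both
    -- updates are trivial.
    rw [h, Matrix.of_apply, Function.update_eq_self, Function.update_eq_self]

/-- The factors are scalars, so from here on the order of the gates and of the noise is irrelevant.
-/
theorem runInstrs_apply {Q : Type} [Fintype Q] [DecidableEq Q] (c : List (Instr Q))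
    (hc : ∀ g ∈ c, g.IsDiagonal) (ρ : Op Q) (z z' : Q → Bit) :
    runInstrs c ρ z z' = (c.map fun g => g.factor z z').prod * ρ z z' := by
  induction c generalizing ρ with
  | nil => simp [runInstrs]
  | cons g c ih =>
    have h : runInstrs (g :: c) ρ = runInstrs c (g.apply ρ) := rfl
    rw [h, ih (fun g' hg' => hc g' (List.mem_cons_of_mem _ hg')),
      Instr.apply_apply (hc g List.mem_cons_self), List.map_cons, List.prod_cons]
    ring

/-! ### The instructions of one step -/

namespace CSSCode

variable {n : ℕ} {C : CSSCode n} {L : ℕ}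

/-- The number of stabilizers of kind `κ` that act on qubit `i`. -/
def deg (C : CSSCode n) (κ : Kind) (i : Fin n) : ℕ :=
  (Finset.univ.filter fun p => i ∈ C.supp κ p).card

/-- This count and the next one make the running numbering of the noise in `checkInstrs` end exactly
where `numLoc` prescribes, whatever the order of the gates. -/
theorem Schedule.countP_fst (sch : C.Schedule L) (r : Fin L) (κ : Kind) (p : Fin (C.num κ)) :
    (sch.gates r κ).countP (fun g => g.1 = p) = (C.supp κ p).card := by
  rw [List.countP_eq_length_filter, ← List.toFinset_card_of_nodup ((sch.nodup r κ).filter _)]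
  refine Finset.card_nbij' Prod.snd (fun i => (p, i)) ?_ ?_ ?_ ?_
  · rintro ⟨q, i⟩ h
    simp only [List.coe_toFinset, List.mem_filter, decide_eq_true_eq, Set.mem_ofPred_eq,
      sch.mem_iff] at h
    obtain ⟨h, rfl⟩ := h
    exact h
  · intro i h
    simpa [sch.mem_iff] using h
  · rintro ⟨q, i⟩ h
    simp only [List.coe_toFinset, List.mem_filter, decide_eq_true_eq, Set.mem_ofPred_eq] at h
    simp [h.2]
  · intro i _
    rfl

theorem Schedule.countP_snd (sch : C.Schedule L) (r : Fin L) (κ : Kind) (i : Fin n) :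
    (sch.gates r κ).countP (fun g => g.2 = i) = C.deg κ i := by
  rw [List.countP_eq_length_filter, ← List.toFinset_card_of_nodup ((sch.nodup r κ).filter _)]
  refine Finset.card_nbij' Prod.fst (fun p => (p, i)) ?_ ?_ ?_ ?_
  · rintro ⟨p, j⟩ h
    simp only [List.coe_toFinset, List.mem_filter, decide_eq_true_eq, Set.mem_ofPred_eq,
      sch.mem_iff] at h
    obtain ⟨h, rfl⟩ := h
    simpa using h
  · intro p h
    simpa [sch.mem_iff] using h
  · rintro ⟨p, j⟩ h
    simp only [List.coe_toFinset, List.mem_filter, decide_eq_true_eq, Set.mem_ofPred_eq] at h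
    simp [h.2]
  · intro p _
    rfl

theorem Schedule.prod_gates (sch : C.Schedule L) (r : Fin L) (κ : Kind)
    (f : Fin (C.num κ) × Fin n → ℂ) :
    ((sch.gates r κ).map f).prod = ∏ p, ∏ i ∈ C.supp κ p, f (p, i) := by
  rw [← List.prod_toFinset f (sch.nodup r κ)]
  have h : (sch.gates r κ).toFinset = Finset.univ.filter fun g => g.2 ∈ C.supp κ g.1 := by
    ext ⟨p, i⟩
    simp [sch.mem_iff]
  rw [h, Finset.prod_filter, Fintype.prod_prod_type]
  refine Finset.prod_congr rfl fun p _ => ?_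
  change (∏ i, if i ∈ C.supp κ p then f (p, i) else 1) = _
  rw [Finset.prod_ite_mem, Finset.univ_inter]

/-- One further gate extends the range of noise locations on the single qubit `j`. -/
theorem prod_prod_range_ite {ι : Type*} [Fintype ι] [DecidableEq ι] (j : ι)
    (k : ι → ℕ) (x : ι → ℕ → ℂ) :
    (∏ i, ∏ w ∈ Finset.range (k i + if j = i then 1 else 0), x i w) =
      (∏ i, ∏ w ∈ Finset.range (k i), x i w) * x j (k j) := by
  have h : ∀ i, (∏ w ∈ Finset.range (k i + if j = i then 1 else 0), x i w) =
      (∏ w ∈ Finset.range (k i), x i w) * if j = i then x i (k i) else 1 := by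
    intro i
    split_ifs <;> simp [Finset.prod_range_succ]
  simp only [h, Finset.prod_mul_distrib, Finset.prod_ite_eq, Finset.mem_univ, if_true]

/-- The coefficients of a noise location. -/
abbrev coeff (N : C.Noise L) (γ : C.PhysQubit L) (w : ℕ) : Bit → Bit → ℂ := schurCoeff (N γ w)

/-- The noise of the gates already executed stands as a factor on both sides. This lets the
induction move one gate from `todo` to `done` without dividing by coefficients that may vanish. -/
theorem prod_factor_checkInstrs (N : C.Noise L) (r : Fin L) (κ : Kind)
    (z z' : C.Reg κ → Bit) (done todo : List (Fin (C.num κ) × Fin n))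
    (a a' : Fin (C.num κ) → Bit) (y y' : Fin n → Bit)
    (ha : ∀ p, z (.inr (.inr p)) = a p) (ha' : ∀ p, z' (.inr (.inr p)) = a' p)
    (hy : ∀ i, z (.inr (.inl i)) = y i) (hy' : ∀ i, z' (.inr (.inl i)) = y' i) :
    ((checkInstrs N r κ done todo).map fun g => g.factor z z').prod *
      ((∏ p, ∏ w ∈ Finset.range (done.countP fun g => g.1 = p),
          coeff N (.inr (r, ⟨κ, p⟩)) (1 + w) (a p) (a' p)) *
        ∏ i, ∏ w ∈ Finset.range (done.countP fun g => g.2 = i),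
          coeff N (.inl (r, κ, i)) (2 + w) (y i) (y' i)) =
    (todo.map fun g => sgn (a g.1 * y g.2) * sgn (a' g.1 * y' g.2)).prod *
      ((∏ p, ∏ w ∈ Finset.range ((done.countP fun g => g.1 = p) + todo.countP fun g => g.1 = p),
          coeff N (.inr (r, ⟨κ, p⟩)) (1 + w) (a p) (a' p)) *
        ∏ i, ∏ w ∈ Finset.range ((done.countP fun g => g.2 = i) + todo.countP fun g => g.2 = i),
          coeff N (.inl (r, κ, i)) (2 + w) (y i) (y' i)) := by
  induction todo generalizing done with
  | nil => simp [checkInstrs]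
  | cons g todo ih =>
    obtain ⟨p, i⟩ := g
    have ih' := ih ((p, i) :: done)
    simp only [List.countP_cons, decide_eq_true_eq] at ih' ⊢
    rw [prod_prod_range_ite p _ fun p w => coeff N (.inr (r, ⟨κ, p⟩)) (1 + w) (a p) (a' p),
      prod_prod_range_ite i _ fun i w => coeff N (.inl (r, κ, i)) (2 + w) (y i) (y' i)] at ih'
    simp only [checkInstrs, List.map_cons, List.prod_cons, Instr.factor_cz, Instr.factor_noise,
      ha, ha', hy, hy']
    simp only [add_comm (List.countP _ todo), ← add_assoc] at ih' ⊢
    linear_combination (sgn (a p * y i) * sgn (a' p * y' i)) * ih'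

/-- The noise is known to be diagonal only at locations below `numLoc`; the bounds on the counts
keep every index used in that range. -/
theorem isDiagonal_checkInstrs (N : C.Noise L) (r : Fin L) (κ : Kind)
    (hN : ∀ γ, ∀ w < C.numLoc γ, IsSchur (N γ w))
    (done todo : List (Fin (C.num κ) × Fin n))
    (hp : ∀ p, (done.countP fun g => g.1 = p) + (todo.countP fun g => g.1 = p) ≤
      (C.supp κ p).card)
    (hi : ∀ i, (done.countP fun g => g.2 = i) + (todo.countP fun g => g.2 = i) ≤ C.deg κ i) :
    ∀ g ∈ checkInstrs N r κ done todo, g.IsDiagonal := by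
  induction todo generalizing done with
  | nil => simp [checkInstrs]
  | cons g todo ih =>
    obtain ⟨p, i⟩ := g
    have hp1 := hp p
    have hi1 := hi i
    simp only [List.countP_cons, decide_true, if_true] at hp1 hi1
    have hih := ih ((p, i) :: done)
      (fun q => by have := hp q; simp only [List.countP_cons] at this ⊢; omega)
      (fun j => by have := hi j; simp only [List.countP_cons] at this ⊢; omega)
    simp only [checkInstrs, List.mem_cons]
    rintro g (rfl | rfl | rfl | hg)
    · trivial
    · refine hN _ _ ?_
      simp only [numLoc]
      omega
    · refine hN _ _ ?_
      simp only [numLoc]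
      unfold deg at hi1
      omega
    · exact hih g hg

theorem isSchur_lastNoise (N : C.Noise L) (hN : ∀ γ, ∀ w < C.numLoc γ, IsSchur (N γ w))
    (r : Fin L) (κ : Kind) (i : Fin n) : IsSchur (lastNoise N r κ i) := by
  -- `numLoc` is positive, so the truncated subtraction does name an existing location.
  have h : ∀ γ : C.PhysQubit L, C.numLoc γ - 1 < C.numLoc γ := by
    rintro (⟨r, κ, i⟩ | ⟨r, κ, p⟩) <;> simp only [numLoc] <;> omega
  cases κ with
  | Z => exact hN _ _ (h _)
  | X =>
    simp only [lastNoise]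
    split_ifs
    · exact hN _ _ (h _)
    · exact isSchur_id

theorem isDiagonal_stepInstrs (sch : C.Schedule L) (N : C.Noise L)
    (hN : ∀ γ, ∀ w < C.numLoc γ, IsSchur (N γ w)) (r : Fin L) (κ : Kind) :
    ∀ g ∈ stepInstrs sch N r κ, g.IsDiagonal := by
  intro g hg
  simp only [stepInstrs, prepInstrs, teleInstrs, List.mem_append, List.mem_map, List.mem_flatMap,
    List.mem_cons, List.not_mem_nil, or_false] at hg
  rcases hg with ((⟨i, -, rfl⟩ | ⟨p, -, rfl⟩) | ⟨i, -, rfl | rfl | rfl⟩) | hg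
  · exact hN _ _ (by simp only [numLoc]; omega)
  · exact hN _ _ (by simp only [numLoc]; omega)
  · trivial
  · exact isSchur_lastNoise N hN r κ i
  · exact hN _ _ (by simp only [numLoc]; omega)
  · refine isDiagonal_checkInstrs N r κ hN [] _ (fun p => ?_) (fun i => ?_) g hg
    · simp [sch.countP_fst]
    · simp [sch.countP_snd]

theorem prod_flatMap_finRange {M : Type*} [CommMonoid M] {α : Type*} (m : ℕ) (f : Fin m → List α)
    (x : α → M) :
    (((List.finRange m).flatMap f).map x).prod = ∏ i, ((f i).map x).prod := by
  rw [Fin.prod_univ_def]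
  induction List.finRange m with
  | nil => simp
  | cons a l ih => simp [ih]

/-- The factor of all instructions of a step; `z`, `y`, `a` are the bits of the old qubits, the
fresh qubits and the ancillas. -/
theorem prod_factor_stepInstrs (sch : C.Schedule L) (N : C.Noise L) (r : Fin L) (κ : Kind)
    (z z' y y' : Fin n → Bit) (a a' : Fin (C.num κ) → Bit) :
    ((stepInstrs sch N r κ).map fun g =>
        g.factor (Sum.elim z (Sum.elim y a)) (Sum.elim z' (Sum.elim y' a'))).prod =
      (∏ i, sgn (z i * y i) * sgn (z' i * y' i)) *
      (∏ i, schurCoeff (lastNoise N r κ i) (z i) (z' i)) *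
      (∏ i, ∏ w ∈ Finset.range (2 + C.deg κ i), coeff N (.inl (r, κ, i)) w (y i) (y' i)) *
      (∏ p, ∏ w ∈ Finset.range (1 + (C.supp κ p).card),
        coeff N (.inr (r, ⟨κ, p⟩)) w (a p) (a' p)) *
      ∏ p, ∏ i ∈ C.supp κ p, sgn (a p * y i) * sgn (a' p * y' i) := by
  have h := prod_factor_checkInstrs N r κ (Sum.elim z (Sum.elim y a)) (Sum.elim z' (Sum.elim y' a'))
    [] (sch.gates r κ) a a' y y' (fun _ => rfl) (fun _ => rfl) (fun _ => rfl) (fun _ => rfl)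
  simp only [List.countP_nil, Finset.range_zero, Finset.prod_empty, Finset.prod_const_one, mul_one,
    zero_add, sch.countP_fst, sch.countP_snd, sch.prod_gates] at h
  simp only [stepInstrs, List.map_append, List.prod_append, h, prepInstrs, teleInstrs,
    prod_flatMap_finRange, List.map_map, ← Fin.prod_univ_def, Function.comp_def,
    Instr.factor_cz, Instr.factor_noise, Sum.elim_inl, Sum.elim_inr, List.map_cons, List.map_nil,
    List.prod_cons, List.prod_nil, mul_one,
    Finset.prod_range_add, Finset.prod_mul_distrib, Finset.prod_range_succ, Finset.range_zero,
    Finset.prod_empty, one_mul]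
  ring

end CSSCode

/-! ### The effect of one step -/

theorem sum_sum_elim {A F B M : Type} [Fintype A] [Fintype F] [Fintype B] [DecidableEq A]
    [DecidableEq F] [DecidableEq B] [AddCommMonoid M] (f : (A ⊕ (F ⊕ B) → Bit) → M) :
    ∑ z, f z = ∑ z : A → Bit, ∑ y : F → Bit, ∑ a : B → Bit, f (Sum.elim z (Sum.elim y a)) := by
  rw [← (Equiv.sumArrowEquivProdArrow A (F ⊕ B) Bit).symm.sum_comp f, Fintype.sum_prod_type]
  refine Finset.sum_congr rfl fun z _ => ?_
  rw [← (Equiv.sumArrowEquivProdArrow F B Bit).symm.sum_comp, Fintype.sum_prod_type]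
  rfl

theorem measKraus_elim {A F B : Type} [Fintype A] [Fintype F] [Fintype B] (m : A → Bit)
    (s : B → Bit) (x y : F → Bit) (z : A → Bit) (a : B → Bit) :
    measKraus m s x (Sum.elim z (Sum.elim y a)) =
      if y = x then (∏ i, xBra (m i) (z i)) * ∏ p, xBra (s p) (a p) else 0 := by
  rfl

theorem conjBy_measKraus_apply {A F B : Type} [Fintype A] [Fintype F] [Fintype B] [DecidableEq A]
    [DecidableEq F] [DecidableEq B] (m : A → Bit) (s : B → Bit) (M : Op (A ⊕ (F ⊕ B)))
    (y y' : F → Bit) :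
    conjBy (measKraus m s) M y y' =
      ∑ z' : A → Bit, ∑ a' : B → Bit, ∑ z : A → Bit, ∑ a : B → Bit,
        ((∏ i, xBra (m i) (z i)) * ∏ p, xBra (s p) (a p)) *
          M (Sum.elim z (Sum.elim y a)) (Sum.elim z' (Sum.elim y' a')) *
          star ((∏ i, xBra (m i) (z' i)) * ∏ p, xBra (s p) (a' p)) := by
  have h1 : ∀ z', (measKraus (F := F) m s * M) y z' = ∑ z : A → Bit, ∑ a : B → Bit,
      ((∏ i, xBra (m i) (z i)) * ∏ p, xBra (s p) (a p)) * M (Sum.elim z (Sum.elim y a)) z' := by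
    intro z'
    rw [Matrix.mul_apply, sum_sum_elim]
    refine Finset.sum_congr rfl fun z _ => ?_
    rw [Finset.sum_eq_single y]
    · simp [measKraus_elim]
    · intro x _ hx
      simp [measKraus_elim, hx]
    · simp
  change (measKraus (F := F) m s * M * (measKraus (F := F) m s)ᴴ) y y' = _
  rw [Matrix.mul_apply, sum_sum_elim]
  refine Finset.sum_congr rfl fun z' _ => ?_
  rw [Finset.sum_eq_single y']
  · refine Finset.sum_congr rfl fun a' _ => ?_
    rw [h1, Matrix.conjTranspose_apply, measKraus_elim, if_pos rfl]
    simp only [Finset.sum_mul]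
  · intro x _ hx
    simp [measKraus_elim, hx, Matrix.conjTranspose_apply]
  · simp

/-- Entrywise multiplication by a product of single-qubit coefficients. -/
def schurBy {Q : Type} [Fintype Q] (c : Q → Bit → Bit → ℂ) (ρ : Op Q) : Op Q :=
  Matrix.of fun z z' => (∏ i, c i (z i) (z' i)) * ρ z z'

theorem schurBy_schurBy {Q : Type} [Fintype Q] (c d : Q → Bit → Bit → ℂ) (ρ : Op Q) :
    schurBy c (schurBy d ρ) = schurBy (fun i a b => c i a b * d i a b) ρ := by
  ext z z'
  simp [schurBy, Finset.prod_mul_distrib, mul_assoc]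

theorem schurBy_one {Q : Type} [Fintype Q] (ρ : Op Q) : schurBy (fun _ _ _ => 1) ρ = ρ := by
  ext z z'
  simp [schurBy]

theorem xBra_mul_star (m m' z z' : Bit) :
    xBra m z * star (xBra m' z') = 1 / 2 * (sgn (m * z) * sgn (m' * z')) := by
  have h : (Real.sqrt 2 : ℂ) * (Real.sqrt 2 : ℂ) = 2 := by
    rw [← Complex.ofReal_mul, Real.mul_self_sqrt (by norm_num)]; norm_num
  have h' : (Real.sqrt 2 : ℂ) ≠ 0 := by
    intro h0; rw [h0] at h; norm_num at h
  simp only [xBra, star_div₀, star_sgn, Complex.star_def, Complex.conj_ofReal]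
  rw [div_mul_div_comm, h]
  ring

namespace CSSCode

variable {n : ℕ} {C : CSSCode n} {L : ℕ}

/-- The parities of the supports of the stabilizers of kind `κ`. -/
def parity (C : CSSCode n) (κ : Kind) (y : Fin n → Bit) : Fin (C.num κ) → Bit :=
  fun p => ∑ i ∈ C.supp κ p, y i

/-- The amplitude of a step for the computational basis state `a` of the ancillas. -/
def kern (C : CSSCode n) (κ : Kind) (m : Fin n → Bit) (s a : Fin (C.num κ) → Bit) : Op (Fin n) :=
  Matrix.of fun y z => (∏ i, 1 / 2 * sgn (z i * (m i + y i))) *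
    ∏ p, 1 / 2 * sgn (a p * (s p + C.parity κ y p))

/-- The effect of a step when the fresh qubits suffer the noise `cF` at its end, and the ancillas
the noise `cA`. -/
def lumpedStep (C : CSSCode n) (κ : Kind) (cF : Fin n → Bit → Bit → ℂ)
    (cA : Fin (C.num κ) → Bit → Bit → ℂ) (m : Fin n → Bit) (s : Fin (C.num κ) → Bit)
    (ρ : Op (Fin n)) : Op (Fin n) :=
  schurBy cF (∑ a', ∑ a, (∏ p, cA p (a p) (a' p)) • (C.kern κ m s a * ρ * (C.kern κ m s a')ᴴ))

theorem lumpedStep_apply (κ : Kind) (cF : Fin n → Bit → Bit → ℂ)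
    (cA : Fin (C.num κ) → Bit → Bit → ℂ) (m : Fin n → Bit) (s : Fin (C.num κ) → Bit)
    (ρ : Op (Fin n)) (y y' : Fin n → Bit) :
    C.lumpedStep κ cF cA m s ρ y y' =
      ∑ z', ∑ a', ∑ z, ∑ a, (∏ i, cF i (y i) (y' i)) * ((∏ p, cA p (a p) (a' p)) *
        (C.kern κ m s a y z * ρ z z' * star (C.kern κ m s a' y' z'))) := by
  have h : ∀ a a' : Fin (C.num κ) → Bit, (C.kern κ m s a * ρ * (C.kern κ m s a')ᴴ) y y' =
      ∑ z', ∑ z, C.kern κ m s a y z * ρ z z' * star (C.kern κ m s a' y' z') := by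
    intro a a'
    rw [Matrix.mul_apply]
    refine Finset.sum_congr rfl fun z' _ => ?_
    rw [Matrix.mul_apply, Finset.sum_mul, Matrix.conjTranspose_apply]
  simp only [lumpedStep, schurBy, Matrix.of_apply, Matrix.sum_apply, Matrix.smul_apply, h,
    smul_eq_mul, Finset.mul_sum]
  rw [Finset.sum_comm (s := (Finset.univ : Finset (Fin n → Bit)))]
  refine Finset.sum_congr rfl fun a' _ => ?_
  rw [Finset.sum_comm]
  exact Finset.sum_congr rfl fun z' _ => Finset.sum_comm

/-- Each factor 1/2 in `kern` is a measurement amplitude 1/√2 times an amplitude 1/√2 of the state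
|+⟩. On the right-hand side the latter appear paired from the two sides, as the density-matrix
entries 1/2. -/
theorem kern_mul_star (κ : Kind) (m : Fin n → Bit) (s a a' : Fin (C.num κ) → Bit)
    (y z y' z' : Fin n → Bit) :
    C.kern κ m s a y z * star (C.kern κ m s a' y' z') =
      ((∏ i, xBra (m i) (z i)) * ∏ p, xBra (s p) (a p)) *
        star ((∏ i, xBra (m i) (z' i)) * ∏ p, xBra (s p) (a' p)) *
        ((∏ _i : Fin n, 1 / 2) * ∏ _p : Fin (C.num κ), 1 / 2) *
        ((∏ i, sgn (z i * y i) * sgn (z' i * y' i)) *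
          ∏ p, ∏ i ∈ C.supp κ p, sgn (a p * y i) * sgn (a' p * y' i)) := by
  have hF : (∏ i, 1 / 2 * sgn (z i * (m i + y i))) * star (∏ i, 1 / 2 * sgn (z' i * (m i + y' i))) =
      (∏ i, xBra (m i) (z i)) * star (∏ i, xBra (m i) (z' i)) * (∏ _i : Fin n, 1 / 2) *
        ∏ i, sgn (z i * y i) * sgn (z' i * y' i) := by
    simp only [star_prod, ← Finset.prod_mul_distrib, xBra_mul_star]
    refine Finset.prod_congr rfl fun i _ => ?_
    rw [star_mul', star_sgn, mul_add, mul_add, sgn_add, sgn_add, mul_comm (z i), mul_comm (z' i)]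
    simp
    ring
  have hA : (∏ p, 1 / 2 * sgn (a p * (s p + C.parity κ y p))) *
        star (∏ p, 1 / 2 * sgn (a' p * (s p + C.parity κ y' p))) =
      (∏ p, xBra (s p) (a p)) * star (∏ p, xBra (s p) (a' p)) *
        (∏ _p : Fin (C.num κ), 1 / 2) *
        ∏ p, ∏ i ∈ C.supp κ p, sgn (a p * y i) * sgn (a' p * y' i) := by
    simp only [star_prod, ← Finset.prod_mul_distrib, xBra_mul_star]
    refine Finset.prod_congr rfl fun p _ => ?_
    rw [star_mul', star_sgn, mul_add, mul_add, sgn_add, sgn_add, mul_comm (a p), mul_comm (a' p),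
      parity, parity, Finset.mul_sum, Finset.mul_sum, sgn_sum, sgn_sum, Finset.prod_mul_distrib]
    simp
    ring
  simp only [kern, Matrix.of_apply]
  rw [star_mul', star_mul', mul_mul_mul_comm, hF, hA]
  ring

/-- Since everything between preparation and measurement is diagonal, the noise on the old qubits
may act before the step and that on the fresh qubits after it. The fresh qubits receive here only `2
+ deg` locations: their noise after the next teleportation gate belongs to the following step. -/
theorem step_eq_lumpedStep (sch : C.Schedule L) (N : C.Noise L)
    (hN : ∀ γ, ∀ w < C.numLoc γ, IsSchur (N γ w)) (r : Fin L) (κ : Kind)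
    (m : Fin n → Bit) (s : Fin (C.num κ) → Bit) (ρ : Op (Fin n)) :
    step sch N r κ m s ρ =
      C.lumpedStep κ
        (fun i a b => ∏ w ∈ Finset.range (2 + C.deg κ i), coeff N (.inl (r, κ, i)) w a b)
        (fun p a b => ∏ w ∈ Finset.range (1 + (C.supp κ p).card), coeff N (.inr (r, ⟨κ, p⟩)) w a b)
        m s (schurBy (fun i => schurCoeff (lastNoise N r κ i)) ρ) := by
  ext y y'
  rw [lumpedStep_apply, step, conjBy_measKraus_apply]
  refine Finset.sum_congr rfl fun z' _ => Finset.sum_congr rfl fun a' _ =>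
    Finset.sum_congr rfl fun z _ => Finset.sum_congr rfl fun a _ => ?_
  rw [runInstrs_apply _ (isDiagonal_stepInstrs sch N hN r κ), prod_factor_stepInstrs]
  have hplus : attachPlus (B := Fin n ⊕ Fin (C.num κ)) ρ (Sum.elim z (Sum.elim y a))
      (Sum.elim z' (Sum.elim y' a')) =
      ρ z z' * ((∏ _i : Fin n, 1 / 2) * ∏ _p : Fin (C.num κ), 1 / 2) := by
    simp only [attachPlus, tensor, Matrix.of_apply, Fintype.prod_sum_type]
    rfl
  rw [hplus, mul_right_comm (C.kern κ m s a y z), kern_mul_star]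
  simp only [schurBy, Matrix.of_apply]
  ring

end CSSCode

/-! ### Folds over all rounds -/

/-- An invariant relating two computations that run through the rounds in parallel; the relation may
depend on the number of completed rounds. -/
theorem foldl_finRange_rel {α β : Type*} {L : ℕ} (f : α → Fin L → α) (g : β → Fin L → β)
    (P : ℕ → α → β → Prop) {x : α} {y : β} (h0 : P 0 x y)
    (hs : ∀ (r : Fin L) (x : α) (y : β), P r x y → P (r + 1) (f x r) (g y r)) :
    P L ((List.finRange L).foldl f x) ((List.finRange L).foldl g y) := by
  induction L with
  | zero => simpa using h0
  | succ L ih =>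
    rw [List.finRange_succ_last, List.foldl_append, List.foldl_append, List.foldl_map,
      List.foldl_map]
    exact hs (Fin.last L) _ _
      (ih (fun x r => f x r.castSucc) (fun y r => g y r.castSucc) fun r x y h => hs r.castSucc x y h)

/-- Multilinearity: a composition of sums of linear maps is the sum over all choices of one summand
in each round. -/
theorem foldl_finRange_sum {J M : Type*} [Fintype J] [AddCommGroup M] [Module ℂ M] {L : ℕ}
    (w : Fin L → J → ℂ) (Φ : Fin L → J → M →ₗ[ℂ] M) (x : M) :
    (List.finRange L).foldl (fun x r => ∑ j, w r j • Φ r j x) x =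
      ∑ j : Fin L → J, (∏ r, w r (j r)) • (List.finRange L).foldl (fun x r => Φ r (j r) x) x := by
  induction L with
  | zero => simp
  | succ L ih =>
    have h := ih (fun r => w r.castSucc) (fun r => Φ r.castSucc)
    rw [List.finRange_succ_last, List.foldl_append, List.foldl_map, h,
      ← (Fin.snocEquiv fun _ => J).sum_comp, Fintype.sum_prod_type]
    simp only [List.foldl_cons, List.foldl_nil, map_sum, map_smul, Finset.smul_sum]
    refine Finset.sum_congr rfl fun j _ => Finset.sum_congr rfl fun i _ => ?_
    rw [Fin.prod_univ_castSucc, List.foldl_append, List.foldl_map, smul_smul, mul_comm]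
    simp [Fin.snocEquiv]

theorem foldl_conj {α β τ : Type*} [Fintype α] [Fintype β] (K K' : τ → Matrix α α ℂ)
    (M M' : Matrix α β ℂ) (ρ : Matrix β β ℂ) (l : List τ) :
    l.foldl (fun σ r => K r * σ * (K' r)ᴴ) (M * ρ * M'ᴴ) =
      l.foldl (fun M r => K r * M) M * ρ * (l.foldl (fun M r => K' r * M) M')ᴴ := by
  induction l generalizing M M' with
  | nil => rfl
  | cons r l ih =>
    rw [List.foldl_cons, List.foldl_cons, List.foldl_cons, ← ih]
    simp only [Matrix.conjTranspose_mul, Matrix.mul_assoc]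

/-! ### Expansion of diagonal noise in Pauli errors -/

/-- The tensor product of `Z^{b_i}`. -/
def Zop {Q : Type} [Fintype Q] [DecidableEq Q] (b : Q → Bit) : Op Q :=
  Matrix.diagonal fun y => sgn (b ⬝ᵥ y)

theorem prod_eq_sum_chi {ι : Type} [Fintype ι] [DecidableEq ι] (c : ι → Bit → Bit → ℂ)
    (y y' : ι → Bit) :
    ∏ i, c i (y i) (y' i) =
      ∑ e : ι → Bit, ∑ e' : ι → Bit,
        (∏ i, chi (c i) (e i) (e' i)) * (sgn (e ⬝ᵥ y) * sgn (e' ⬝ᵥ y')) := by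
  have h : ∀ i, c i (y i) (y' i) =
      ∑ g, ∑ g', chi (c i) g g' * (sgn (g * y i) * sgn (g' * y' i)) := fun i => (sum_chi _ _ _).symm
  rw [Finset.prod_congr rfl fun i _ => h i]
  simp only [Finset.prod_univ_sum, Fintype.piFinset_univ, sgn_dotProduct, Finset.prod_mul_distrib]

theorem schurBy_eq_sum {Q : Type} [Fintype Q] [DecidableEq Q] (c : Q → Bit → Bit → ℂ) (ρ : Op Q) :
    schurBy c ρ = ∑ e : Q → Bit, ∑ e' : Q → Bit,
      (∏ i, chi (c i) (e i) (e' i)) • (Zop e * ρ * (Zop e')ᴴ) := by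
  ext z z'
  rw [schurBy, Matrix.of_apply, prod_eq_sum_chi]
  simp only [Finset.sum_mul, Matrix.sum_apply, Matrix.smul_apply, smul_eq_mul]
  refine Finset.sum_congr rfl fun e _ => Finset.sum_congr rfl fun e' _ => ?_
  simp only [Zop, Matrix.diagonal_conjTranspose, Matrix.mul_diagonal, Matrix.diagonal_mul,
    Pi.star_apply, star_sgn]
  ring

theorem sum_comm_pairs {α β γ δ M : Type*} [Fintype α] [Fintype β] [Fintype γ] [Fintype δ]
    [AddCommMonoid M] (f : α → β → γ → δ → M) :
    ∑ a, ∑ b, ∑ c, ∑ d, f a b c d = ∑ c, ∑ d, ∑ a, ∑ b, f a b c d := by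
  calc ∑ a, ∑ b, ∑ c, ∑ d, f a b c d
      = ∑ x : α × β, ∑ y : γ × δ, f x.1 x.2 y.1 y.2 := by simp only [Fintype.sum_prod_type]
    _ = ∑ y : γ × δ, ∑ x : α × β, f x.1 x.2 y.1 y.2 := Finset.sum_comm
    _ = _ := by simp only [Fintype.sum_prod_type]

theorem prod_kind {M : Type*} [CommMonoid M] (f : Kind → M) : ∏ κ, f κ = f .X * f .Z := by
  have h : (Finset.univ : Finset Kind) = {Kind.X, Kind.Z} := rfl
  rw [h, Finset.prod_pair (by decide)]

/-- A family indexed by the two kinds is a pair. -/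
def piKindEquiv (T : Kind → Type*) : (∀ κ, T κ) ≃ T .X × T .Z where
  toFun E := (E .X, E .Z)
  invFun x := fun κ => match κ with
    | .X => x.1
    | .Z => x.2
  left_inv E := by funext κ; cases κ <;> rfl
  right_inv x := rfl

theorem sum_piKind {M : Type*} [AddCommMonoid M] {T : Kind → Type*} [∀ κ, Fintype (T κ)]
    (f : T .X → T .Z → M) : ∑ E : (κ : Kind) → T κ, f (E .X) (E .Z) = ∑ x, ∑ y, f x y := by
  rw [← Fintype.sum_prod_type', ← (piKindEquiv T).sum_comp]
  rfl

theorem sum_piKind_pairs {M : Type*} [AddCommMonoid M] {T : Kind → Type*} [∀ κ, Fintype (T κ)]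
    (g : T .X → T .Z → T .X → T .Z → M) :
    ∑ E : (κ : Kind) → T κ, ∑ E' : (κ : Kind) → T κ, g (E .X) (E .Z) (E' .X) (E' .Z) =
      ∑ y, ∑ y', ∑ x, ∑ x', g x y x' y' := by
  refine (sum_piKind fun x y => ∑ E' : (κ : Kind) → T κ, g x y (E' .X) (E' .Z)).trans ?_
  rw [Finset.sum_comm]
  refine Finset.sum_congr rfl fun y _ => ?_
  rw [Finset.sum_comm (s := (Finset.univ : Finset (T .Z)))]
  refine Finset.sum_congr rfl fun x _ => ?_
  rw [sum_piKind (g x y), Finset.sum_comm]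

namespace CSSCode

variable {n : ℕ} {C : CSSCode n} {L : ℕ}

variable (C) in
/-- Bits on the code qubits and on the stabilizers of kind `κ`: the outcomes of a step, or the
`Z` errors on the fresh qubits and on the ancillas of a step. -/
abbrev StepBits (κ : Kind) := (Fin n → Bit) × (Fin (C.num κ) → Bit)

/-- The Kraus operator of a step with outcomes `o` and `Z` errors `ε`. -/
def errKraus (C : CSSCode n) (κ : Kind) (o ε : C.StepBits κ) : Op (Fin n) :=
  Zop ε.1 * ∑ a, sgn (ε.2 ⬝ᵥ a) • C.kern κ o.1 o.2 a

/-- Fresh qubits and ancillas are expanded separately. The ancilla errors enter as characters of `a`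
and are absorbed into the sums over ancilla basis states. -/
theorem lumpedStep_eq_sum (κ : Kind) (cF : Fin n → Bit → Bit → ℂ)
    (cA : Fin (C.num κ) → Bit → Bit → ℂ) (o : C.StepBits κ) (ρ : Op (Fin n)) :
    C.lumpedStep κ cF cA o.1 o.2 ρ =
      ∑ ε : C.StepBits κ, ∑ ε' : C.StepBits κ,
        ((∏ i, chi (cF i) (ε.1 i) (ε'.1 i)) * ∏ p, chi (cA p) (ε.2 p) (ε'.2 p)) •
          (C.errKraus κ o ε * ρ * (C.errKraus κ o ε')ᴴ) := by
  have hA : (∑ a', ∑ a, (∏ p, cA p (a p) (a' p)) •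
      (C.kern κ o.1 o.2 a * ρ * (C.kern κ o.1 o.2 a')ᴴ)) =
      ∑ f, ∑ f', (∏ p, chi (cA p) (f p) (f' p)) •
        ((∑ a, sgn (f ⬝ᵥ a) • C.kern κ o.1 o.2 a) * ρ *
          (∑ a, sgn (f' ⬝ᵥ a) • C.kern κ o.1 o.2 a)ᴴ) := by
    have h : ∀ a a', (∏ p, cA p (a p) (a' p)) •
        (C.kern κ o.1 o.2 a * ρ * (C.kern κ o.1 o.2 a')ᴴ) =
        ∑ f, ∑ f', ((∏ p, chi (cA p) (f p) (f' p)) * (sgn (f ⬝ᵥ a) * sgn (f' ⬝ᵥ a'))) •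
          (C.kern κ o.1 o.2 a * ρ * (C.kern κ o.1 o.2 a')ᴴ) := by
      intro a a'
      rw [prod_eq_sum_chi cA]
      simp only [Finset.sum_smul]
    simp only [h]
    rw [sum_comm_pairs]
    refine Finset.sum_congr rfl fun f _ => Finset.sum_congr rfl fun f' _ => ?_
    simp only [Matrix.conjTranspose_sum, Matrix.mul_sum, Matrix.sum_mul, Finset.smul_sum,
      Matrix.conjTranspose_smul, star_sgn, Matrix.smul_mul, Matrix.mul_smul, smul_smul]
    refine Finset.sum_congr rfl fun a' _ => Finset.sum_congr rfl fun a _ => ?_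
    congr 1
    ring
  rw [lumpedStep, hA, schurBy_eq_sum]
  simp only [Fintype.sum_prod_type]
  refine Finset.sum_congr rfl fun e _ => Eq.trans ?_ Finset.sum_comm
  refine Finset.sum_congr rfl fun e' _ => ?_
  rw [Matrix.mul_sum, Matrix.sum_mul, Finset.smul_sum]
  refine Finset.sum_congr rfl fun f _ => ?_
  rw [Matrix.mul_sum, Matrix.sum_mul, Finset.smul_sum]
  refine Finset.sum_congr rfl fun f' _ => ?_
  rw [Matrix.mul_smul, Matrix.smul_mul, smul_smul]
  simp only [errKraus, Matrix.conjTranspose_mul, Matrix.mul_assoc]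

/-! ### Lumping the noise of each physical qubit -/

/-- The product of the coefficients of all noise locations on a physical qubit. -/
def totalCoeff (N : C.Noise L) (γ : C.PhysQubit L) (a b : Bit) : ℂ :=
  ∏ w ∈ Finset.range (C.numLoc γ), coeff N γ w a b

/-- A round of the circuit in which each physical qubit suffers the noise `c` at once. -/
def lumpedRound (c : C.PhysQubit L → Bit → Bit → ℂ) (o : C.Outcome L) (ρ : Op (Fin n))
    (r : Fin L) : Op (Fin n) :=
  C.lumpedStep .Z (fun i => c (.inl (r, .Z, i))) (fun p => c (.inr (r, ⟨.Z, p⟩)))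
    (o r .Z).1 (o r .Z).2
    (C.lumpedStep .X (fun i => c (.inl (r, .X, i))) (fun p => c (.inr (r, ⟨.X, p⟩)))
      (o r .X).1 (o r .X).2 ρ)

theorem schurBy_lumpedStep (κ : Kind) (c d : Fin n → Bit → Bit → ℂ)
    (cA : Fin (C.num κ) → Bit → Bit → ℂ) (m : Fin n → Bit) (s : Fin (C.num κ) → Bit)
    (ρ : Op (Fin n)) :
    schurBy d (C.lumpedStep κ c cA m s ρ) =
      C.lumpedStep κ (fun i a b => d i a b * c i a b) cA m s ρ :=
  schurBy_schurBy _ _ _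

/-- The noise that the code qubits still have to suffer after `r` rounds. -/
def pendingCoeff (N : C.Noise L) (r : ℕ) (i : Fin n) : Bit → Bit → ℂ :=
  if h : r < L then schurCoeff (lastNoise N ⟨r, h⟩ .X i) else fun _ _ => 1

/-- Invariant: after `r` rounds the actual state, once the pending noise has acted on it, equals the
state of the lumped circuit. Nothing is pending at the start, because the input is noiseless, nor at
the end. -/
theorem branch_eq_foldl_lumpedRound (sch : C.Schedule L) (N : C.Noise L)
    (hN : ∀ γ, ∀ w < C.numLoc γ, IsSchur (N γ w)) (o : C.Outcome L) (ρ : Op (Fin n)) :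
    branch sch N o ρ = (List.finRange L).foldl (lumpedRound (totalCoeff N) o) ρ := by
  have key := foldl_finRange_rel
    (fun ρ r => step sch N r .Z (o r .Z).1 (o r .Z).2 (step sch N r .X (o r .X).1 (o r .X).2 ρ))
    (lumpedRound (totalCoeff N) o) (fun r x y => schurBy (pendingCoeff N r) x = y)
    (x := ρ) (y := ρ) ?_ ?_
  · have h : pendingCoeff N L = fun _ _ _ => 1 := by
      funext i
      simp [pendingCoeff]
    rw [h, schurBy_one] at key
    exact key
  · have h : pendingCoeff N 0 = fun _ _ _ => 1 := by
      funext i a b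
      unfold pendingCoeff
      split_ifs
      · simp [lastNoise]
      · rfl
    rw [h, schurBy_one]
  · rintro r x _ rfl
    have hX : pendingCoeff N r = fun i => schurCoeff (lastNoise N r .X i) := by
      funext i
      simp [pendingCoeff]
    rw [step_eq_lumpedStep sch N hN, step_eq_lumpedStep sch N hN, schurBy_lumpedStep,
      schurBy_lumpedStep, ← hX, lumpedRound]
    have hnX : ∀ i, C.numLoc (L := L) (.inl (r, .X, i)) = 2 + C.deg .X i + 1 := by
      intro i
      simp [numLoc, deg]
    congr 1
    · funext i a b
      unfold pendingCoeff totalCoeff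
      -- If another round follows, the last location on the fresh qubit is the pending one; the
      -- output qubits of the final round have one location fewer and nothing pending.
      split_ifs with h
      · have hnZ : C.numLoc (L := L) (.inl (r, .Z, i)) = 2 + C.deg .Z i + 1 := by
          simp [numLoc, deg, h.ne]
        rw [hnZ, Finset.prod_range_succ, mul_comm]
        simp [lastNoise, hnZ]
      · have h' : r.val + 1 = L := le_antisymm r.isLt (not_lt.mp h)
        have hnZ : C.numLoc (L := L) (.inl (r, .Z, i)) = 2 + C.deg .Z i := by
          simp [numLoc, deg, h']
        rw [hnZ, one_mul]
    · congr 1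
      funext i a b
      rw [totalCoeff, hnX, Finset.prod_range_succ, mul_comm]
      simp [lastNoise, hnX]

/-- The Kraus operator of a round with outcomes `o` and `Z` errors `E`. -/
def roundKraus (o E : C.Outcome L) (r : Fin L) : Op (Fin n) :=
  C.errKraus .Z (o r .Z) (E r .Z) * C.errKraus .X (o r .X) (E r .X)

/-- The coefficient of the errors `E` on the left and `E'` on the right of the state. -/
def roundWeight (c : C.PhysQubit L → Bit → Bit → ℂ) (r : Fin L) (E E' : ∀ κ, C.StepBits κ) : ℂ :=
  ∏ κ, ((∏ i, chi (c (.inl (r, κ, i))) ((E κ).1 i) ((E' κ).1 i)) *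
    ∏ p, chi (c (.inr (r, ⟨κ, p⟩))) ((E κ).2 p) ((E' κ).2 p))

theorem lumpedRound_eq_sum (c : C.PhysQubit L → Bit → Bit → ℂ) (o : C.Outcome L) (ρ : Op (Fin n))
    (r : Fin L) :
    lumpedRound c o ρ r = ∑ E : ∀ κ, C.StepBits κ, ∑ E' : ∀ κ, C.StepBits κ,
      roundWeight c r E E' •
        (C.errKraus .Z (o r .Z) (E .Z) * C.errKraus .X (o r .X) (E .X) * ρ *
          (C.errKraus .Z (o r .Z) (E' .Z) * C.errKraus .X (o r .X) (E' .X))ᴴ) := by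
  simp only [roundWeight, prod_kind]
  refine Eq.trans ?_ (sum_piKind_pairs (T := C.StepBits) fun x y x' y' =>
    (((∏ i, chi (c (.inl (r, .X, i))) (x.1 i) (x'.1 i)) *
        ∏ p, chi (c (.inr (r, ⟨.X, p⟩))) (x.2 p) (x'.2 p)) *
      ((∏ i, chi (c (.inl (r, .Z, i))) (y.1 i) (y'.1 i)) *
        ∏ p, chi (c (.inr (r, ⟨.Z, p⟩))) (y.2 p) (y'.2 p))) •
        (C.errKraus .Z (o r .Z) y * C.errKraus .X (o r .X) x * ρ *
          (C.errKraus .Z (o r .Z) y' * C.errKraus .X (o r .X) x')ᴴ)).symm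
  rw [lumpedRound, lumpedStep_eq_sum, lumpedStep_eq_sum]
  refine Finset.sum_congr rfl fun y _ => Finset.sum_congr rfl fun y' _ => ?_
  simp only [Matrix.mul_sum, Matrix.sum_mul, Finset.smul_sum, Matrix.mul_smul, Matrix.smul_mul,
    smul_smul, Matrix.conjTranspose_mul, Matrix.mul_assoc]
  refine Finset.sum_congr rfl fun x _ => Finset.sum_congr rfl fun x' _ => ?_
  congr 1
  ring

/-- The encoded operator `V` after all rounds with outcomes `o` and `Z` errors `E`. -/
def circuitKraus {k : ℕ} (o E : C.Outcome L) (V : Matrix (Fin n → Bit) (Fin k → Bit) ℂ) :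
    Matrix (Fin n → Bit) (Fin k → Bit) ℂ :=
  (List.finRange L).foldl (fun M r => roundKraus o E r * M) V

/-- Choosing a pair of errors in every round amounts to choosing two error histories, one building
up the left factor and the other the right factor. -/
theorem foldl_lumpedRound_eq_sum {k : ℕ} (c : C.PhysQubit L → Bit → Bit → ℂ) (o : C.Outcome L)
    (V : Matrix (Fin n → Bit) (Fin k → Bit) ℂ) (ρ : Op (Fin k)) :
    (List.finRange L).foldl (lumpedRound c o) (V * ρ * Vᴴ) =
      ∑ E : C.Outcome L, ∑ E' : C.Outcome L, (∏ r, roundWeight c r (E r) (E' r)) •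
        (circuitKraus o E V * ρ * (circuitKraus o E' V)ᴴ) := by
  have h : lumpedRound c o = fun ρ r => ∑ x : (∀ κ, C.StepBits κ) × (∀ κ, C.StepBits κ),
      roundWeight c r x.1 x.2 •
        ((LinearMap.mulRight ℂ (C.errKraus .Z (o r .Z) (x.2 .Z) *
            C.errKraus .X (o r .X) (x.2 .X))ᴴ) ∘ₗ
          (LinearMap.mulLeft ℂ (C.errKraus .Z (o r .Z) (x.1 .Z) *
            C.errKraus .X (o r .X) (x.1 .X)))) ρ := by
    funext ρ r
    rw [lumpedRound_eq_sum, Fintype.sum_prod_type]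
    rfl
  rw [h, foldl_finRange_sum fun (r : Fin L) (x : (∀ κ, C.StepBits κ) × (∀ κ, C.StepBits κ)) =>
    roundWeight c r x.1 x.2,
    ← (Equiv.arrowProdEquivProdArrow (Fin L) (fun _ => ∀ κ, C.StepBits κ)
      (fun _ => ∀ κ, C.StepBits κ)).symm.sum_comp, Fintype.sum_prod_type]
  refine Finset.sum_congr rfl fun E _ => Finset.sum_congr rfl fun E' _ => ?_
  rw [circuitKraus, circuitKraus, ← foldl_conj]
  rfl

end CSSCode

/-! ### Pauli strings and the Hadamard transform -/

section PauliStrings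

variable {n : ℕ}

/-- The tensor product of `X^{a_i}`. -/
def Xop (a : Fin n → Bit) : Op (Fin n) := Matrix.of fun y z => if y = z + a then 1 else 0

/-- The Hadamard transform of all qubits, up to normalization. -/
def had (m : ℕ) : Op (Fin m) := Matrix.of fun y z => ∏ i, 1 / 2 * sgn (z i * y i)

theorem bits_add_self {ι : Type*} (a : ι → Bit) : a + a = 0 := funext fun i => bit_add_self (a i)

theorem bits_eq_add_iff {ι : Type*} (y z a : ι → Bit) : y = z + a ↔ y + a = z := by
  constructor
  · rintro rfl; rw [add_assoc, bits_add_self, add_zero]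
  · rintro rfl; rw [add_assoc, bits_add_self, add_zero]

theorem Xop_mul_apply {β : Type*} (a : Fin n → Bit) (M : Matrix (Fin n → Bit) β ℂ) (y : Fin n → Bit)
    (x : β) : (Xop a * M) y x = M (y + a) x := by
  simp [Matrix.mul_apply, Xop, bits_eq_add_iff]

theorem mul_Xop_apply {β : Type*} (a : Fin n → Bit) (M : Matrix β (Fin n → Bit) ℂ) (y : β)
    (z : Fin n → Bit) : (M * Xop a) y z = M y (z + a) := by
  simp [Matrix.mul_apply, Xop]

theorem Zop_mul_apply {β : Type*} (b : Fin n → Bit) (M : Matrix (Fin n → Bit) β ℂ) (y : Fin n → Bit)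
    (x : β) : (Zop b * M) y x = sgn (b ⬝ᵥ y) * M y x := by
  simp [Zop, Matrix.diagonal_mul]

theorem mul_Zop_apply {β : Type*} (b : Fin n → Bit) (M : Matrix β (Fin n → Bit) ℂ) (y : β)
    (z : Fin n → Bit) : (M * Zop b) y z = M y z * sgn (b ⬝ᵥ z) := by
  simp [Zop, Matrix.mul_diagonal]

theorem Xop_mul_Xop (a b : Fin n → Bit) : Xop a * Xop b = Xop (a + b) := by
  ext y z
  rw [Xop_mul_apply]
  simp only [Xop, Matrix.of_apply, bits_eq_add_iff, add_assoc]

theorem Zop_mul_Zop (a b : Fin n → Bit) : Zop a * Zop b = Zop (a + b) := by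
  simp [Zop, Matrix.diagonal_mul_diagonal, add_dotProduct, sgn_add]

theorem Zop_mul_Xop (b a : Fin n → Bit) : Zop b * Xop a = sgn (b ⬝ᵥ a) • (Xop a * Zop b) := by
  ext y z
  rw [Zop_mul_apply, Matrix.smul_apply, mul_Zop_apply]
  simp only [Xop, Matrix.of_apply, smul_eq_mul]
  split_ifs with h
  · rw [h, dotProduct_add, sgn_add]; ring
  · simp

theorem Xop_zero : Xop (0 : Fin n → Bit) = 1 := by
  ext y z
  simp [Xop, Matrix.one_apply]

theorem Zop_zero : Zop (0 : Fin n → Bit) = 1 := by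
  simp [Zop]

theorem conjTranspose_Xop (a : Fin n → Bit) : (Xop a)ᴴ = Xop a := by
  ext y z
  rw [Matrix.conjTranspose_apply]
  simp only [Xop, Matrix.of_apply]
  have h : z = y + a ↔ y = z + a := by rw [bits_eq_add_iff, eq_comm]
  simp only [h]
  split_ifs <;> simp

theorem conjTranspose_Zop (b : Fin n → Bit) : (Zop b)ᴴ = Zop b := by
  simp only [Zop, Matrix.diagonal_conjTranspose]
  congr 1
  funext y
  simp

theorem had_apply (y z : Fin n → Bit) : had n y z = (∏ _i : Fin n, 1 / 2) * sgn (z ⬝ᵥ y) := by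
  rw [had, Matrix.of_apply, Finset.prod_mul_distrib, sgn_dotProduct]

theorem had_mul_Zop (b : Fin n → Bit) : had n * Zop b = Xop b * had n := by
  ext y z
  rw [mul_Zop_apply, Xop_mul_apply, had_apply, had_apply, dotProduct_add, sgn_add,
    dotProduct_comm z b, mul_assoc]

theorem had_mul_Xop (a : Fin n → Bit) : had n * Xop a = Zop a * had n := by
  ext y z
  rw [mul_Xop_apply, Zop_mul_apply, had_apply, had_apply, add_dotProduct, sgn_add]
  ring

/-- With entries ±1/2 per qubit, `had n` is 2^(-n/2) times the unitary Hadamard transform. The two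
steps of a round thus yield the factor `(1 / 2) ^ n` of `roundFactor`. -/
theorem had_mul_had : had n * had n = (1 / 2 : ℂ) ^ n • (1 : Op (Fin n)) := by
  ext y z
  simp only [Matrix.mul_apply, had, Matrix.of_apply, ← Finset.prod_mul_distrib]
  have h := Finset.prod_univ_sum (fun _ : Fin n => (Finset.univ : Finset Bit))
    (fun i x => (1 / 2 * sgn (x * y i)) * (1 / 2 * sgn (z i * x)))
  rw [Fintype.piFinset_univ] at h
  rw [← h]
  have h' : ∀ i, ∑ x : Bit, (1 / 2 * sgn (x * y i)) * (1 / 2 * sgn (z i * x)) =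
      1 / 2 * if y i = z i then 1 else 0 := by
    intro i
    rcases bit_cases (y i) with hy | hy <;> rcases bit_cases (z i) with hz | hz <;>
      simp [hy, hz, sum_bit]
    all_goals norm_num
  simp only [h', Finset.prod_mul_distrib, Finset.prod_const, Finset.card_univ, Fintype.card_fin,
    Matrix.smul_apply, Matrix.one_apply, smul_eq_mul, Finset.prod_ite_zero, Finset.mem_univ,
    forall_true_left, funext_iff, one_pow]

end PauliStrings

/-! ### Parity projections and the normal form of a step -/

namespace CSSCode

variable {n : ℕ} {C : CSSCode n} {L : ℕ}

theorem parity_add (κ : Kind) (y z : Fin n → Bit) :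
    C.parity κ (y + z) = C.parity κ y + C.parity κ z := by
  funext p
  simp [parity, Finset.sum_add_distrib]

theorem parity_zero (κ : Kind) : C.parity κ 0 = 0 := by
  funext p
  simp [parity]

/-- The projection onto the basis states with stabilizer parities `s`. -/
def proj (C : CSSCode n) (κ : Kind) (s : Fin (C.num κ) → Bit) : Op (Fin n) :=
  Matrix.diagonal fun y => if C.parity κ y = s then 1 else 0

theorem proj_mul_apply {β : Type*} (κ : Kind) (s : Fin (C.num κ) → Bit)
    (M : Matrix (Fin n → Bit) β ℂ) (y : Fin n → Bit) (x : β) :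
    (C.proj κ s * M) y x = if C.parity κ y = s then M y x else 0 := by
  simp [proj, Matrix.diagonal_mul]

theorem proj_mul_Xop (κ : Kind) (s : Fin (C.num κ) → Bit) (a : Fin n → Bit) :
    C.proj κ s * Xop a = Xop a * C.proj κ (s + C.parity κ a) := by
  ext y z
  rw [proj_mul_apply, proj, Matrix.mul_diagonal]
  simp only [Xop, Matrix.of_apply]
  by_cases h : y = z + a
  · subst h
    simp [parity_add, ← bits_eq_add_iff, eq_comm (a := C.parity κ z)]
  · simp [h]

theorem proj_mul_Zop (κ : Kind) (s : Fin (C.num κ) → Bit) (b : Fin n → Bit) :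
    C.proj κ s * Zop b = Zop b * C.proj κ s := by
  simp only [proj, Zop, Matrix.diagonal_mul_diagonal, mul_comm]

/-- The sum over ancilla basis states is a character sum, which enforces that the parities equal
`o.2 + ε.2`. A `Z` error on an ancilla is therefore the same as a flip of its measured outcome. -/
theorem errKraus_eq (κ : Kind) (o ε : C.StepBits κ) :
    C.errKraus κ o ε = Zop ε.1 * C.proj κ (o.2 + ε.2) * Xop o.1 * had n := by
  rw [errKraus, Matrix.mul_assoc, Matrix.mul_assoc]
  congr 1
  ext y z
  rw [proj_mul_apply, Xop_mul_apply, Matrix.sum_apply]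
  simp only [Matrix.smul_apply, smul_eq_mul, kern, Matrix.of_apply, had, Pi.add_apply,
    sgn_dotProduct]
  have h := Finset.prod_univ_sum (fun _ : Fin (C.num κ) => (Finset.univ : Finset Bit))
    (fun p x => sgn (ε.2 p * x) * (1 / 2 * sgn (x * (o.2 p + C.parity κ y p))))
  rw [Fintype.piFinset_univ] at h
  have h' : ∀ p, ∑ x : Bit, sgn (ε.2 p * x) * (1 / 2 * sgn (x * (o.2 p + C.parity κ y p))) =
      if C.parity κ y p = o.2 p + ε.2 p then 1 else 0 := by
    intro p
    have h11 : (1 : Bit) + 1 = 0 := bit_add_self 1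
    rcases bit_cases (ε.2 p) with h1 | h1 <;> rcases bit_cases (o.2 p) with h2 | h2 <;>
      rcases bit_cases (C.parity κ y p) with h3 | h3 <;>
      simp [h1, h2, h3, sum_bit, h11] <;> norm_num
  simp only [h', Finset.prod_ite_zero, Finset.mem_univ, forall_true_left,
    Finset.prod_const_one] at h
  have hA : ∀ a : Fin (C.num κ) → Bit, (∏ p, sgn (ε.2 p * a p)) *
      ((∏ i, 1 / 2 * sgn (z i * (o.1 i + y i))) *
        ∏ p, 1 / 2 * sgn (a p * (o.2 p + C.parity κ y p))) =
      (∏ i, 1 / 2 * sgn (z i * (y i + o.1 i))) *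
        ∏ p, sgn (ε.2 p * a p) * (1 / 2 * sgn (a p * (o.2 p + C.parity κ y p))) := by
    intro a
    simp only [add_comm (o.1 _), Finset.prod_mul_distrib]
    ring
  rw [Finset.sum_congr rfl fun a _ => hA a, ← Finset.mul_sum, ← h]
  simp only [funext_iff, Pi.add_apply, mul_ite, mul_one, mul_zero]

/-! ### Code states -/

/-- The indicator of the support of a stabilizer. -/
def ind (C : CSSCode n) (κ : Kind) (p : Fin (C.num κ)) : Fin n → Bit :=
  fun i => if i ∈ C.supp κ p then 1 else 0

theorem ind_dotProduct (κ : Kind) (p : Fin (C.num κ)) (y : Fin n → Bit) :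
    C.ind κ p ⬝ᵥ y = C.parity κ y p := by
  simp [ind, dotProduct, parity, Finset.sum_ite_mem]

theorem stab_X (p : Fin (C.num .X)) : C.stab .X p = Xop (C.ind .X p) := by
  ext y z
  simp only [stab, tensor, Matrix.of_apply, Xop, ind, funext_iff, Pi.add_apply, Kind.pauli]
  have h : ∀ i, (if i ∈ C.supp .X p then pauliX else 1) (y i) (z i) =
      if y i = z i + (if i ∈ C.supp .X p then 1 else 0) then (1 : ℂ) else 0 := by
    intro i
    split_ifs <;> simp_all [pauliX_apply, Matrix.one_apply]
  simp only [h, Finset.prod_ite_zero, Finset.mem_univ, forall_true_left, Finset.prod_const_one]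

theorem stab_Z (p : Fin (C.num .Z)) : C.stab .Z p = Zop (C.ind .Z p) := by
  ext y z
  simp only [stab, tensor, Matrix.of_apply, Zop, Matrix.diagonal_apply, sgn_dotProduct, ind,
    Kind.pauli]
  have h : ∀ i, (if i ∈ C.supp .Z p then pauliZ else 1) (y i) (z i) =
      if y i = z i then sgn ((if i ∈ C.supp .Z p then 1 else 0) * y i) else 0 := by
    intro i
    split_ifs <;> simp_all [pauliZ_apply, Matrix.one_apply]
  simp only [h, Finset.prod_ite_zero, Finset.mem_univ, forall_true_left, funext_iff]

theorem IsEncoder.stab_mul {k : ℕ} {V : Matrix (Fin n → Bit) (Fin k → Bit) ℂ} (hV : C.IsEncoder V)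
    (κ : Kind) (p : Fin (C.num κ)) : C.stab κ p * V = V := by
  apply Matrix.ext_of_mulVec_single
  intro x
  rw [← Matrix.mulVec_mulVec]
  exact (hV.2 _).mp ⟨_, rfl⟩ κ p

/-- A column fixed by all these `Z` operators is supported on basis states with even parities. -/
theorem proj_mul_of_Zop_mul {k : ℕ} (κ : Kind) {M : Matrix (Fin n → Bit) (Fin k → Bit) ℂ}
    (hM : ∀ p, Zop (C.ind κ p) * M = M) (s : Fin (C.num κ) → Bit) :
    C.proj κ s * M = if s = 0 then M else 0 := by
  have h0 : ∀ y x, M y x ≠ 0 → C.parity κ y = 0 := by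
    intro y x hyx
    funext p
    have h := congrFun (congrFun (hM p) y) x
    rw [Zop_mul_apply, ind_dotProduct] at h
    rcases bit_cases (C.parity κ y p) with h1 | h1
    · exact h1
    · rw [h1, sgn_one] at h
      exact absurd (by linear_combination (-1 / 2) * h) hyx
  ext y x
  rw [proj_mul_apply]
  by_cases hyx : M y x = 0
  · split_ifs <;> simp [hyx]
  · rw [h0 y x hyx]
    by_cases hs : s = 0
    · simp [hs]
    · simp [hs, Ne.symm hs]

theorem IsEncoder.proj_Z_mul {k : ℕ} {V : Matrix (Fin n → Bit) (Fin k → Bit) ℂ}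
    (hV : C.IsEncoder V) (s : Fin (C.num .Z) → Bit) :
    C.proj .Z s * V = if s = 0 then V else 0 :=
  proj_mul_of_Zop_mul .Z (fun p => by rw [← stab_Z, hV.stab_mul]) s

/-- The Hadamard transform turns `X` stabilizers into `Z` stabilizers, so `had n * V` satisfies the
parity checks of kind `X`. -/
theorem IsEncoder.proj_X_mul {k : ℕ} {V : Matrix (Fin n → Bit) (Fin k → Bit) ℂ}
    (hV : C.IsEncoder V) (s : Fin (C.num .X) → Bit) :
    C.proj .X s * (had n * V) = if s = 0 then had n * V else 0 :=
  proj_mul_of_Zop_mul .X (fun p => by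
    rw [← Matrix.mul_assoc, ← had_mul_Xop, Matrix.mul_assoc, ← stab_X, hV.stab_mul]) s

/-! ### The circuit acting on a code state -/

/-- The sum of the terms of the first `ℓ` rounds. -/
def partialSum {G : Type*} [AddCommMonoid G] (f : Fin L → G) (ℓ : ℕ) : G :=
  ∑ r with r.val < ℓ, f r

theorem filter_val_lt_succ (r : Fin L) :
    (Finset.univ.filter fun r' : Fin L => r'.val < r.val + 1) =
      insert r (Finset.univ.filter fun r' : Fin L => r'.val < r.val) := by
  ext r'
  simp only [Finset.mem_filter, Finset.mem_univ, true_and, Finset.mem_insert, Fin.ext_iff]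
  omega

theorem partialSum_succ {G : Type*} [AddCommMonoid G] (f : Fin L → G) (r : Fin L) :
    partialSum f (r + 1) = partialSum f r + f r := by
  rw [partialSum, filter_val_lt_succ, Finset.sum_insert (by simp), add_comm]
  rfl

theorem partialSum_zero {G : Type*} [AddCommMonoid G] (f : Fin L → G) : partialSum f 0 = 0 := by
  simp [partialSum]

theorem partialSum_all {G : Type*} [AddCommMonoid G] (f : Fin L → G) :
    partialSum f L = ∑ r, f r := by
  simp [partialSum]

/-- The exponent of `X` of the Pauli operator accumulated in the first `ℓ` rounds. -/
def xAcc (o E : C.Outcome L) (ℓ : ℕ) : Fin n → Bit :=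
  partialSum (fun r => (o r .Z).1 + (E r .X).1) ℓ

/-- The exponent of `Z` of the Pauli operator accumulated in the first `ℓ` rounds. -/
def zAcc (o E : C.Outcome L) (ℓ : ℕ) : Fin n → Bit :=
  partialSum (fun r => (o r .X).1 + (E r .Z).1) ℓ

/-- The outcomes `o` of round `r` can occur with the errors `E`. -/
def Consistent (o E : C.Outcome L) (r : Fin L) : Prop :=
  (o r .X).2 + (E r .X).2 + C.parity .X ((o r .X).1 + zAcc o E r) = 0 ∧
    (o r .Z).2 + (E r .Z).2 + C.parity .Z (xAcc o E (r + 1)) = 0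

instance (o E : C.Outcome L) (r : Fin L) : Decidable (Consistent o E r) :=
  inferInstanceAs (Decidable (_ ∧ _))

/-- The sign picked up in round `r`, as an exponent of `-1`. -/
def roundSign (o E : C.Outcome L) (r : Fin L) : Bit :=
  (o r .X).1 ⬝ᵥ xAcc o E r + (E r .Z).1 ⬝ᵥ xAcc o E (r + 1)

/-- The factor picked up in round `r`. -/
def roundFactor (o E : C.Outcome L) (r : Fin L) : ℂ :=
  (1 / 2) ^ n * (if Consistent o E r then sgn (roundSign o E r) else 0)

/-- The Pauli operators are moved to the left through the Hadamard transform and the projection. The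
projection, shifted by the parities of the `X` part, then meets the transformed code state and
either fixes or kills it. -/
theorem errKraus_X_mul {k : ℕ} {V : Matrix (Fin n → Bit) (Fin k → Bit) ℂ} (hV : C.IsEncoder V)
    (o ε : C.StepBits .X) (a b : Fin n → Bit) :
    C.errKraus .X o ε * (Xop a * Zop b * V) =
      (if o.2 + ε.2 + C.parity .X (o.1 + b) = 0 then sgn (o.1 ⬝ᵥ a) else 0) •
        (Zop (ε.1 + a) * Xop (o.1 + b) * (had n * V)) := by
  have h1 : Xop o.1 * had n * (Xop a * Zop b) =
      sgn (o.1 ⬝ᵥ a) • (Zop a * Xop (o.1 + b) * had n) := by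
    have h2 : Xop o.1 * Zop a = sgn (o.1 ⬝ᵥ a) • (Zop a * Xop o.1) := by
      rw [Zop_mul_Xop, smul_smul, dotProduct_comm a, sgn_mul_self, one_smul]
    calc Xop o.1 * had n * (Xop a * Zop b) = Xop o.1 * (had n * Xop a) * Zop b := by
          simp only [Matrix.mul_assoc]
      _ = (Xop o.1 * Zop a) * (had n * Zop b) := by rw [had_mul_Xop]; simp only [Matrix.mul_assoc]
      _ = sgn (o.1 ⬝ᵥ a) • (Zop a * (Xop o.1 * Xop b) * had n) := by
          rw [h2, had_mul_Zop, Matrix.smul_mul]; simp only [Matrix.mul_assoc]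
      _ = _ := by rw [Xop_mul_Xop]
  calc C.errKraus .X o ε * (Xop a * Zop b * V)
      = Zop ε.1 * C.proj .X (o.2 + ε.2) * (Xop o.1 * had n * (Xop a * Zop b)) * V := by
        rw [errKraus_eq]; simp only [Matrix.mul_assoc]
    _ = sgn (o.1 ⬝ᵥ a) • (Zop ε.1 * (C.proj .X (o.2 + ε.2) * Zop a) * Xop (o.1 + b) *
          (had n * V)) := by
        rw [h1, Matrix.mul_smul, Matrix.smul_mul]; simp only [Matrix.mul_assoc]
    _ = sgn (o.1 ⬝ᵥ a) • ((Zop ε.1 * Zop a) * (C.proj .X (o.2 + ε.2) * Xop (o.1 + b)) *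
          (had n * V)) := by
        rw [proj_mul_Zop]; simp only [Matrix.mul_assoc]
    _ = sgn (o.1 ⬝ᵥ a) • (Zop (ε.1 + a) * Xop (o.1 + b) *
          (C.proj .X (o.2 + ε.2 + C.parity .X (o.1 + b)) * (had n * V))) := by
        rw [proj_mul_Xop, Zop_mul_Zop]; simp only [Matrix.mul_assoc]
    _ = _ := by
        rw [hV.proj_X_mul]
        split_ifs <;> simp

/-- The mirror image of `errKraus_X_mul`: the second Hadamard transform returns to the code space,
where the `Z` parities are even. -/
theorem errKraus_Z_mul {k : ℕ} {V : Matrix (Fin n → Bit) (Fin k → Bit) ℂ} (hV : C.IsEncoder V)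
    (o ε : C.StepBits .Z) (a b : Fin n → Bit) :
    C.errKraus .Z o ε * (Zop a * Xop b * (had n * V)) =
      ((1 / 2) ^ n * if o.2 + ε.2 + C.parity .Z (o.1 + a) = 0 then sgn (ε.1 ⬝ᵥ (o.1 + a)) else 0) •
        (Xop (o.1 + a) * Zop (b + ε.1) * V) := by
  have h1 : Xop o.1 * had n * (Zop a * Xop b * had n) =
      (1 / 2 : ℂ) ^ n • (Xop (o.1 + a) * Zop b) := by
    calc Xop o.1 * had n * (Zop a * Xop b * had n) = Xop o.1 * (had n * Zop a) * Xop b * had n := by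
          simp only [Matrix.mul_assoc]
      _ = (Xop o.1 * Xop a) * (had n * Xop b) * had n := by
          rw [had_mul_Zop]; simp only [Matrix.mul_assoc]
      _ = Xop (o.1 + a) * Zop b * (had n * had n) := by
          rw [had_mul_Xop, Xop_mul_Xop]; simp only [Matrix.mul_assoc]
      _ = _ := by rw [had_mul_had, Matrix.mul_smul, Matrix.mul_one]
  calc C.errKraus .Z o ε * (Zop a * Xop b * (had n * V))
      = Zop ε.1 * C.proj .Z (o.2 + ε.2) * (Xop o.1 * had n * (Zop a * Xop b * had n)) * V := by
        rw [errKraus_eq]; simp only [Matrix.mul_assoc]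
    _ = (1 / 2 : ℂ) ^ n • (Zop ε.1 * (C.proj .Z (o.2 + ε.2) * Xop (o.1 + a)) * (Zop b * V)) := by
        rw [h1, Matrix.mul_smul, Matrix.smul_mul]; simp only [Matrix.mul_assoc]
    _ = (1 / 2 : ℂ) ^ n • ((Zop ε.1 * Xop (o.1 + a)) *
          ((C.proj .Z (o.2 + ε.2 + C.parity .Z (o.1 + a)) * Zop b) * V)) := by
        rw [proj_mul_Xop]; simp only [Matrix.mul_assoc]
    _ = ((1 / 2 : ℂ) ^ n * sgn (ε.1 ⬝ᵥ (o.1 + a))) • (Xop (o.1 + a) * (Zop ε.1 * Zop b) *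
          (C.proj .Z (o.2 + ε.2 + C.parity .Z (o.1 + a)) * V)) := by
        rw [proj_mul_Zop, Zop_mul_Xop, Matrix.smul_mul, smul_smul]; simp only [Matrix.mul_assoc]
    _ = _ := by
        rw [hV.proj_Z_mul, Zop_mul_Zop, add_comm ε.1 b]
        split_ifs <;> simp

theorem roundKraus_mul {k : ℕ} {V : Matrix (Fin n → Bit) (Fin k → Bit) ℂ} (hV : C.IsEncoder V)
    (o E : C.Outcome L) (r : Fin L) :
    roundKraus o E r * (Xop (xAcc o E r) * Zop (zAcc o E r) * V) =
      roundFactor o E r • (Xop (xAcc o E (r + 1)) * Zop (zAcc o E (r + 1)) * V) := by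
  have hx : xAcc o E (r + 1) = (o r .Z).1 + ((E r .X).1 + xAcc o E r) := by
    rw [xAcc, partialSum_succ, ← xAcc]; abel
  have hz : zAcc o E (r + 1) = (o r .X).1 + zAcc o E r + (E r .Z).1 := by
    rw [zAcc, partialSum_succ, ← zAcc]; abel
  rw [roundKraus, Matrix.mul_assoc, errKraus_X_mul hV, Matrix.mul_smul, errKraus_Z_mul hV,
    smul_smul, ← hx, ← hz]
  congr 1
  by_cases h1 : (o r .X).2 + (E r .X).2 + C.parity .X ((o r .X).1 + zAcc o E r) = 0 <;>
    by_cases h2 : (o r .Z).2 + (E r .Z).2 + C.parity .Z (xAcc o E (r + 1)) = 0 <;>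
    simp [roundFactor, Consistent, roundSign, sgn_add, h1, h2]
  ring

theorem circuitKraus_eq {k : ℕ} {V : Matrix (Fin n → Bit) (Fin k → Bit) ℂ} (hV : C.IsEncoder V)
    (o E : C.Outcome L) :
    circuitKraus o E V = (∏ r, roundFactor o E r) • (Xop (xAcc o E L) * Zop (zAcc o E L) * V) := by
  have key := foldl_finRange_rel
    (fun (M : Matrix (Fin n → Bit) (Fin k → Bit) ℂ) r => roundKraus o E r * M)
    (fun (_ : Unit) (_ : Fin L) => ())
    (fun ℓ M _ => M = (∏ r : Fin L with r.val < ℓ, roundFactor o E r) •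
      (Xop (xAcc o E ℓ) * Zop (zAcc o E ℓ) * V)) (x := V) (y := ()) ?_ ?_
  · simpa [circuitKraus] using key
  · simp [xAcc, zAcc, partialSum_zero, Xop_zero, Zop_zero]
  · rintro r M _ rfl
    rw [Matrix.mul_smul, roundKraus_mul hV, smul_smul, filter_val_lt_succ,
      Finset.prod_insert (by simp), mul_comm]

theorem frame_eq (o : C.Outcome L) :
    frame o = Xop (∑ r, (o r .Z).1) * Zop (∑ r, (o r .X).1) := by
  ext y z
  rw [mul_Zop_apply]
  simp only [frame, tensor, Matrix.of_apply, Xop, funext_iff, Pi.add_apply, sgn_dotProduct,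
    Finset.sum_apply]
  have h : ∀ (a b u v : Bit), (pauliX ^ a.val * pauliZ ^ b.val) u v =
      (if u = v + a then 1 else 0) * sgn (b * v) := by
    intro a b u v
    have hx : (pauliX ^ a.val) u v = if u = v + a then 1 else 0 := by
      rcases bit_cases a with rfl | rfl
      · simp [Matrix.one_apply]
      · simp [ZMod.val_one, pauliX_apply]
    rw [pauliZ, Matrix.diagonal_pow, Matrix.mul_diagonal, hx]
    rcases bit_cases b with rfl | rfl <;> simp [ZMod.val_one]
  simp only [h, Finset.prod_mul_distrib, Finset.prod_ite_zero, Finset.mem_univ, forall_true_left,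
    Finset.prod_const_one]

/-- The amplitude of the outcomes `o` with the errors `E`, after undoing the Pauli frame. -/
def amplitude (o E : C.Outcome L) : ℂ :=
  (∏ r, roundFactor o E r) * sgn ((∑ r, (E r .X).1) ⬝ᵥ ∑ r, (o r .X).1)

/-- The frame cancels exactly the outcome part of the accumulated exponents. Outcomes survive only
in the scalar, which is what makes the later sum over outcomes a sum of scalars. -/
theorem frame_mul_circuitKraus {k : ℕ} {V : Matrix (Fin n → Bit) (Fin k → Bit) ℂ}
    (hV : C.IsEncoder V) (o E : C.Outcome L) :
    (frame o)ᴴ * circuitKraus o E V =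
      amplitude o E • (Xop (∑ r, (E r .X).1) * Zop (∑ r, (E r .Z).1) * V) := by
  rw [circuitKraus_eq hV, frame_eq, Matrix.conjTranspose_mul, conjTranspose_Xop, conjTranspose_Zop,
    xAcc, zAcc, partialSum_all, partialSum_all, Finset.sum_add_distrib, Finset.sum_add_distrib,
    Matrix.mul_smul, amplitude, mul_smul]
  congr 1
  set a := ∑ r, (o r .Z).1
  set b := ∑ r, (o r .X).1
  set e := ∑ r, (E r .X).1
  set f := ∑ r, (E r .Z).1
  calc Zop b * Xop a * (Xop (a + e) * Zop (b + f) * V)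
      = Zop b * (Xop a * Xop (a + e)) * Zop (b + f) * V := by simp only [Matrix.mul_assoc]
    _ = Zop b * Xop e * Zop (b + f) * V := by
        rw [Xop_mul_Xop, ← add_assoc, bits_add_self, zero_add]
    _ = sgn (e ⬝ᵥ b) • (Xop e * (Zop b * Zop (b + f)) * V) := by
        rw [Zop_mul_Xop, dotProduct_comm b, Matrix.smul_mul, Matrix.smul_mul]
        simp only [Matrix.mul_assoc]
    _ = _ := by rw [Zop_mul_Zop, ← add_assoc, bits_add_self, zero_add]

/-! ### Cancellation of the terms with different errors on the two sides -/

/-- The total sign, as an exponent of `-1`. -/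
def phase (o E : C.Outcome L) : Bit :=
  ∑ r, roundSign o E r + (∑ r, (E r .X).1) ⬝ᵥ ∑ r, (o r .X).1

theorem amplitude_eq (o E : C.Outcome L) :
    amplitude o E = (∏ _r : Fin L, (1 / 2 : ℂ) ^ n) *
      if ∀ r, Consistent o E r then sgn (phase o E) else 0 := by
  simp only [amplitude, roundFactor, Finset.prod_mul_distrib, Finset.prod_ite_zero,
    Finset.mem_univ, forall_true_left, phase, sgn_add, sgn_sum]
  split_ifs <;> ring

theorem star_amplitude (o E : C.Outcome L) : star (amplitude o E) = amplitude o E := by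
  rw [amplitude_eq]
  split_ifs <;> simp

theorem partialSum_add {G : Type*} [AddCommMonoid G] (f g : Fin L → G) (ℓ : ℕ) :
    partialSum (fun r => f r + g r) ℓ = partialSum f ℓ + partialSum g ℓ :=
  Finset.sum_add_distrib

/-- Flips of the teleportation outcomes, with the flips of the stabilizer outcomes that keep the
cluster state stabilizer outcomes. -/
def outcomeShift (d : Fin L → Kind → Fin n → Bit) : C.Outcome L := fun r κ =>
  (d r κ, C.parity κ (partialSum (fun r => d r κ) (r + 1)))

theorem syndrome_add (o o' : C.Outcome L) : syndrome (o + o') = syndrome o + syndrome o' := by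
  funext r κ p
  simp only [syndrome, Pi.add_apply, Prod.fst_add, Prod.snd_add, Finset.sum_add_distrib]
  split_ifs <;> ring

/-- The flips of the stabilizer outcomes are parities of running sums, so their difference between
consecutive rounds is the parity of the teleportation flips of the round. -/
theorem syndrome_outcomeShift (d : Fin L → Kind → Fin n → Bit) :
    syndrome (outcomeShift (C := C) d) = 0 := by
  funext r κ p
  have h1 : C.parity κ (partialSum (fun r => d r κ) (r + 1)) p =
      C.parity κ (partialSum (fun r => d r κ) r) p + C.parity κ (d r κ) p := by
    rw [partialSum_succ, parity_add, Pi.add_apply]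
  have h2 : (if 0 < r.val then
      (outcomeShift (C := C) d ⟨r.val - 1, lt_of_le_of_lt (Nat.sub_le _ _) r.isLt⟩ κ).2 p else 0) =
      C.parity κ (partialSum (fun r => d r κ) r) p := by
    split_ifs with h
    · simp only [outcomeShift]
      rw [Nat.sub_add_cancel h]
    · rw [Nat.eq_zero_of_not_pos h, partialSum_zero, parity_zero]
      rfl
  rw [syndrome, h2]
  change C.parity κ (partialSum (fun r => d r κ) (r + 1)) p + _ + C.parity κ (d r κ) p = 0
  rw [h1]
  generalize C.parity κ (partialSum (fun r => d r κ) r) p = x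
  generalize C.parity κ (d r κ) p = y
  linear_combination (x + y) * (CharTwo.two_eq_zero (R := Bit))

theorem xAcc_add_shift (o E : C.Outcome L) (d : Fin L → Kind → Fin n → Bit) (ℓ : ℕ) :
    xAcc (o + outcomeShift d) E ℓ = xAcc o E ℓ + partialSum (fun r => d r .Z) ℓ := by
  rw [xAcc, xAcc, ← partialSum_add]
  congr 1
  funext r
  exact add_right_comm _ _ _

theorem zAcc_add_shift (o E : C.Outcome L) (d : Fin L → Kind → Fin n → Bit) (ℓ : ℕ) :
    zAcc (o + outcomeShift d) E ℓ = zAcc o E ℓ + partialSum (fun r => d r .X) ℓ := by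
  rw [zAcc, zAcc, ← partialSum_add]
  congr 1
  funext r
  exact add_right_comm _ _ _

/-- The same running sums enter the accumulated Pauli exponents, so the two changes in each
condition cancel modulo 2. -/
theorem consistent_add_shift (o E : C.Outcome L) (d : Fin L → Kind → Fin n → Bit) (r : Fin L) :
    Consistent (o + outcomeShift d) E r ↔ Consistent o E r := by
  have hX : ((o + outcomeShift d : C.Outcome L) r .X).2 + (E r .X).2 +
      C.parity .X (((o + outcomeShift d : C.Outcome L) r .X).1 + zAcc (o + outcomeShift d) E r) =
      (o r .X).2 + (E r .X).2 + C.parity .X ((o r .X).1 + zAcc o E r) := by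
    have h : ((o + outcomeShift d : C.Outcome L) r .X).1 + zAcc (o + outcomeShift d) E r =
        ((o r .X).1 + zAcc o E r) + partialSum (fun r => d r .X) (r + 1) := by
      rw [zAcc_add_shift, partialSum_succ]
      change (o r .X).1 + d r .X + _ = _
      abel
    rw [h, parity_add]
    change (o r .X).2 + C.parity .X (partialSum (fun r => d r .X) (r + 1)) + _ + _ = _
    generalize C.parity .X (partialSum (fun r => d r .X) (r + 1)) = x
    rw [add_right_comm _ x, add_add_add_comm, bits_add_self, add_zero]
  have hZ : ((o + outcomeShift d : C.Outcome L) r .Z).2 + (E r .Z).2 +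
      C.parity .Z (xAcc (o + outcomeShift d) E (r + 1)) =
      (o r .Z).2 + (E r .Z).2 + C.parity .Z (xAcc o E (r + 1)) := by
    rw [xAcc_add_shift, parity_add]
    change (o r .Z).2 + C.parity .Z (partialSum (fun r => d r .Z) (r + 1)) + _ + _ = _
    generalize C.parity .Z (partialSum (fun r => d r .Z) (r + 1)) = x
    rw [add_right_comm _ x, add_add_add_comm, bits_add_self, add_zero]
  rw [Consistent, Consistent, hX, hZ]

/-- The change of the relative sign of the errors `E` and `E'` under a shift of the outcomes. -/
theorem phase_add_shift (o E E' : C.Outcome L) (d : Fin L → Kind → Fin n → Bit) :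
    phase (o + outcomeShift d) E + phase (o + outcomeShift d) E' =
      phase o E + phase o E' +
        (∑ r, (d r .X ⬝ᵥ partialSum (fun r => (E r .X).1 + (E' r .X).1) r +
            ((E r .Z).1 + (E' r .Z).1) ⬝ᵥ partialSum (fun r => d r .Z) (r + 1)) +
          (∑ r, ((E r .X).1 + (E' r .X).1)) ⬝ᵥ ∑ r, d r .X) := by
  have hE : ∀ ℓ, partialSum (fun r => (E r .X).1 + (E' r .X).1) ℓ = xAcc o E ℓ + xAcc o E' ℓ := by
    intro ℓ
    rw [xAcc, xAcc, ← partialSum_add]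
    congr 1
    funext r
    rw [add_add_add_comm, bits_add_self, zero_add]
  have hr : ∀ r, roundSign (o + outcomeShift d) E r + roundSign (o + outcomeShift d) E' r =
      roundSign o E r + roundSign o E' r +
        (d r .X ⬝ᵥ partialSum (fun r => (E r .X).1 + (E' r .X).1) r +
            ((E r .Z).1 + (E' r .Z).1) ⬝ᵥ partialSum (fun r => d r .Z) (r + 1)) := by
    intro r
    have ho : ((o + outcomeShift d : C.Outcome L) r .X).1 = (o r .X).1 + d r .X := rfl
    simp only [roundSign, xAcc_add_shift, ho, hE, add_dotProduct, dotProduct_add]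
    -- The terms without `E` or `E'` occur once for each of the two patterns and vanish modulo 2.
    linear_combination ((o r .X).1 ⬝ᵥ partialSum (fun r => d r .Z) r +
      d r .X ⬝ᵥ partialSum (fun r => d r .Z) r) * (CharTwo.two_eq_zero (R := Bit))
  have ho : ∑ r, ((o + outcomeShift d : C.Outcome L) r .X).1 = ∑ r, (o r .X).1 + ∑ r, d r .X := by
    rw [← Finset.sum_add_distrib]
    rfl
  have hs := Finset.sum_congr (rfl : (Finset.univ : Finset (Fin L)) = Finset.univ) fun r _ => hr r
  rw [Finset.sum_add_distrib, Finset.sum_add_distrib, Finset.sum_add_distrib] at hs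
  simp only [phase, ho, Finset.sum_add_distrib (f := fun r => (E r .X).1), add_dotProduct,
    dotProduct_add] at hs ⊢
  linear_combination hs

/-- The expression is the tail sum of `f` from `v` on. If all tails vanish, then so do their
consecutive differences, which are the values of `f`. -/
theorem exists_partialSum_add_sum_ne_zero {f : Fin L → Bit} (hf : f ≠ 0) :
    ∃ v : Fin L, partialSum f v + ∑ r, f r = 1 := by
  by_contra! h
  refine hf (funext fun v => ?_)
  have h' : ∀ ℓ ≤ L, partialSum f ℓ = ∑ r, f r := by
    intro ℓ hℓ
    rcases hℓ.lt_or_eq with hℓ | rfl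
    · have h1 := (bit_cases _).resolve_right (h ⟨ℓ, hℓ⟩)
      exact CharTwo.add_eq_zero.mp h1
    · exact partialSum_all f
  have h1 := partialSum_succ f v
  rw [h' _ v.isLt, h' _ v.isLt.le] at h1
  simpa using h1

/-- A flip in round `v` persists in the running sums of all later rounds, so it pairs with the tail
of `f` from `v` on. -/
theorem sum_partialSum_single (f : Fin L → Fin n → Bit) (v : Fin L) (i : Fin n) :
    ∑ r, f r ⬝ᵥ partialSum (fun r' => if r' = v then Pi.single i 1 else 0) (r + 1) =
      partialSum (fun r => f r i) v + ∑ r, f r i := by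
  have h : ∀ ℓ, partialSum (fun r' => if r' = v then (Pi.single i 1 : Fin n → Bit) else 0) ℓ =
      if v.val < ℓ then Pi.single i 1 else 0 := by
    intro ℓ
    simp [partialSum, Finset.sum_ite_eq']
  have h2 : ∀ r, f r ⬝ᵥ partialSum (fun r' => if r' = v then Pi.single i 1 else 0) (r + 1) =
      (if r.val < v.val then f r i else 0) + f r i := by
    intro r
    rw [h]
    by_cases hr : r.val < v.val
    · rw [if_neg (by omega), if_pos hr, bit_add_self, dotProduct_zero]
    · rw [if_pos (by omega), if_neg hr, zero_add]
      simp
  rw [Finset.sum_congr rfl fun r _ => h2 r, Finset.sum_add_distrib, partialSum, Finset.sum_filter]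

/-- If `E` and `E'` have different errors on the fresh qubits, then some shift of the outcomes
changes their relative sign. -/
theorem exists_shift_of_fst_ne {E E' : C.Outcome L} {r : Fin L} {κ : Kind}
    (h : (E r κ).1 ≠ (E' r κ).1) :
    ∃ d : Fin L → Kind → Fin n → Bit, ∀ o : C.Outcome L,
      phase (o + outcomeShift d) E + phase (o + outcomeShift d) E' =
        phase o E + phase o E' + 1 := by
  obtain ⟨i, hi⟩ := Function.ne_iff.mp h
  have hf : (fun r => (E r κ).1 i + (E' r κ).1 i) ≠ 0 := by
    intro h0
    exact hi (CharTwo.add_eq_zero.mp (congrFun h0 r))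
  obtain ⟨v, hv⟩ := exists_partialSum_add_sum_ne_zero hf
  cases κ with
  | Z =>
    -- A single flip at qubit `i` in a round `v` from which the difference of the errors has odd
    -- tail sum.
    refine ⟨fun r κ => if κ = .Z then (if r = v then Pi.single i 1 else 0) else 0, fun o => ?_⟩
    rw [phase_add_shift]
    congr 1
    have hs := sum_partialSum_single (fun r => (E r .Z).1 + (E' r .Z).1) v i
    simp only [Pi.add_apply] at hs
    rw [hv] at hs
    simpa using hs
  | X =>
    refine ⟨fun r κ => if κ = .X then (if r = v then Pi.single i 1 else 0) else 0, fun o => ?_⟩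
    rw [phase_add_shift]
    congr 1
    -- The rounds before `v` contribute through `xAcc`, and all rounds through the frame; together
    -- they leave the tail from `v` on.
    refine Eq.trans ?_ hv
    have hite : ∀ (r : Fin L) (x : Fin n → Bit),
        (if r = v then (Pi.single i 1 : Fin n → Bit) else 0) ⬝ᵥ x = if r = v then x i else 0 := by
      intro r x; split_ifs <;> simp
    simp [hite, partialSum, Finset.sum_add_distrib]

/-- Given the outcomes and the errors on the fresh qubits, the consistency equations determine the
ancilla errors. -/
theorem snd_eq_of_consistent {o E E' : C.Outcome L} (h1 : ∀ r κ, (E r κ).1 = (E' r κ).1)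
    (hE : ∀ r, Consistent o E r) (hE' : ∀ r, Consistent o E' r) : E = E' := by
  have hx : ∀ ℓ, xAcc o E ℓ = xAcc o E' ℓ := fun ℓ => by simp only [xAcc, h1]
  have hz : ∀ ℓ, zAcc o E ℓ = zAcc o E' ℓ := fun ℓ => by simp only [zAcc, h1]
  funext r κ
  refine Prod.ext (h1 r κ) ?_
  cases κ with
  | X =>
    have h := (hE r).1.trans (hE' r).1.symm
    rw [hz] at h
    exact add_left_cancel (add_right_cancel h)
  | Z =>
    have h := (hE r).2.trans (hE' r).2.symm
    rw [hx] at h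
    exact add_left_cancel (add_right_cancel h)

theorem amplitude_mul_add_shift {E E' : C.Outcome L} {d : Fin L → Kind → Fin n → Bit}
    (o : C.Outcome L)
    (h : phase (o + outcomeShift d) E + phase (o + outcomeShift d) E' =
      phase o E + phase o E' + 1) :
    amplitude (o + outcomeShift d) E * amplitude (o + outcomeShift d) E' =
      -(amplitude o E * amplitude o E') := by
  have hs := congrArg sgn h
  simp only [sgn_add, sgn_one] at hs
  simp only [amplitude_eq, consistent_add_shift]
  split_ifs
  · linear_combination (∏ _r : Fin L, (1 / 2 : ℂ) ^ n) ^ 2 * hs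
  · simp
  · simp
  · simp

/-- If `E` and `E'` agree on the fresh qubits, they are never consistent with the same outcomes and
every term is zero. Otherwise a shift of the outcomes keeps `f (syndrome o)` and negates its
coefficient. That the recovery depends on the outcomes through the syndrome alone is essential here.
-/
theorem sum_amplitude_eq_zero {M : Type*} [AddCommGroup M] [Module ℂ M] {E E' : C.Outcome L}
    (h : E ≠ E') (f : C.Syndrome L → M) :
    ∑ o : C.Outcome L, (amplitude o E * amplitude o E') • f (syndrome o) = 0 := by
  by_cases h1 : ∀ r κ, (E r κ).1 = (E' r κ).1
  · refine Finset.sum_eq_zero fun o _ => ?_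
    rw [amplitude_eq, amplitude_eq]
    split_ifs with hE hE'
    · exact absurd (snd_eq_of_consistent h1 hE hE') h
    all_goals simp
  · push Not at h1
    obtain ⟨r, κ, hne⟩ := h1
    obtain ⟨d, hd⟩ := exists_shift_of_fst_ne hne
    -- Reindexing by the shift shows that the sum equals its own negative.
    have hsum := Equiv.sum_comp (Equiv.addRight (outcomeShift (C := C) d))
      fun o : C.Outcome L => (amplitude o E * amplitude o E') • f (syndrome o)
    simp only [Equiv.coe_addRight, syndrome_add, syndrome_outcomeShift, add_zero,
      amplitude_mul_add_shift _ (hd _), neg_smul, Finset.sum_neg_distrib] at hsum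
    have h2 : ∀ x : M, -x = x → x = 0 := fun x hx => by
      have h0 : (2 : ℂ) • x = 0 := by
        rw [two_smul]
        exact add_eq_zero_iff_eq_neg.mpr hx.symm
      exact (smul_eq_zero.mp h0).resolve_left two_ne_zero
    exact h2 _ hsum

/-! ### The average logical channel as a mixture of Pauli errors -/

/-- The error on a physical qubit. -/
def errAt (E : C.Outcome L) : C.PhysQubit L → Bit
  | .inl (r, κ, i) => (E r κ).1 i
  | .inr (r, ⟨κ, p⟩) => (E r κ).2 p

theorem prod_roundWeight (c : C.PhysQubit L → Bit → Bit → ℂ) (E : C.Outcome L) :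
    ∏ r, roundWeight c r (E r) (E r) = ∏ γ, chi (c γ) (errAt E γ) (errAt E γ) := by
  simp only [roundWeight, Finset.prod_mul_distrib, Fintype.prod_sum_type, Fintype.prod_prod_type,
    Fintype.prod_sigma, errAt]

/-- The contribution of the `Z` errors `E` to the average logical channel. -/
def errorTerm {k : ℕ} (V : Matrix (Fin n → Bit) (Fin k → Bit) ℂ)
    (R : C.Syndrome L → Op (Fin n) →ₗ[ℂ] Op (Fin k)) (ρ : Op (Fin k)) (E : C.Outcome L) :
    Op (Fin k) :=
  ∑ o : C.Outcome L, (amplitude o E * amplitude o E) •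
    R (syndrome o) (conjBy (Xop (∑ r, (E r .X).1) * Zop (∑ r, (E r .Z).1) * V) ρ)

/-- The amplitudes and the Pauli operators left after the frame do not involve the noise, which
enters only through its expansion coefficients. Cancellation of the cross terms leaves the diagonal
ones, as if each lumped map had been Pauli twirled. -/
theorem logicalChannel_eq_sum {k : ℕ} (sch : C.Schedule L)
    {V : Matrix (Fin n → Bit) (Fin k → Bit) ℂ} (hV : C.IsEncoder V)
    (R : C.Syndrome L → Op (Fin n) →ₗ[ℂ] Op (Fin k)) (N : C.Noise L)
    (hN : ∀ γ, ∀ w < C.numLoc γ, IsSchur (N γ w)) (ρ : Op (Fin k)) :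
    logicalChannel sch V R N ρ =
      ∑ E : C.Outcome L, (∏ γ, chi (totalCoeff N γ) (errAt E γ) (errAt E γ)) •
        errorTerm V R ρ E := by
  let P : C.Outcome L → Matrix (Fin n → Bit) (Fin k → Bit) ℂ := fun E =>
    Xop (∑ r, (E r .X).1) * Zop (∑ r, (E r .Z).1) * V
  have h1 : ∀ o : C.Outcome L, R (syndrome o) (conjBy (frame o)ᴴ (branch sch N o (conjBy V ρ))) =
      ∑ E : C.Outcome L, ∑ E' : C.Outcome L,
        (∏ r, roundWeight (totalCoeff N) r (E r) (E' r)) •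
          ((amplitude o E * amplitude o E') • R (syndrome o) (P E * ρ * (P E')ᴴ)) := by
    intro o
    have h2 : conjBy V ρ = V * ρ * Vᴴ := rfl
    rw [branch_eq_foldl_lumpedRound sch N hN, h2, foldl_lumpedRound_eq_sum]
    simp only [map_sum, map_smul]
    refine Finset.sum_congr rfl fun E _ => Finset.sum_congr rfl fun E' _ => ?_
    have h3 : conjBy (frame o)ᴴ (circuitKraus o E V * ρ * (circuitKraus o E' V)ᴴ) =
        ((frame o)ᴴ * circuitKraus o E V) * ρ * ((frame o)ᴴ * circuitKraus o E' V)ᴴ := by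
      change (frame o)ᴴ * (circuitKraus o E V * ρ * (circuitKraus o E' V)ᴴ) * ((frame o)ᴴ)ᴴ = _
      simp only [Matrix.conjTranspose_mul, Matrix.mul_assoc]
    rw [h3, frame_mul_circuitKraus hV, frame_mul_circuitKraus hV, Matrix.conjTranspose_smul,
      star_amplitude, Matrix.smul_mul, Matrix.smul_mul, Matrix.mul_smul, smul_smul, map_smul]
  rw [logicalChannel, Finset.sum_congr rfl fun o _ => h1 o, Finset.sum_comm]
  refine Finset.sum_congr rfl fun E _ => ?_
  rw [Finset.sum_comm]
  simp only [← Finset.smul_sum]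
  rw [Finset.sum_eq_single E, prod_roundWeight]
  · rfl
  · intro E' _ hE
    rw [sum_amplitude_eq_zero hE.symm fun σ => R σ (P E * ρ * (P E')ᴴ), smul_zero]
  · simp

/-! ### The Pauli weights of the noise and of its replacements -/

theorem numLoc_ne_zero (γ : C.PhysQubit L) : C.numLoc γ ≠ 0 := by
  rcases γ with ⟨r, κ, i⟩ | ⟨r, κ, p⟩ <;> simp only [numLoc] <;> omega

theorem lumped_isSchur (N : C.Noise L) (γ : C.PhysQubit L)
    (hN : ∀ w < C.numLoc γ, IsSchur (N γ w)) :
    IsSchur (lumped N γ) ∧ ∀ a b, schurCoeff (lumped N γ) a b = totalCoeff N γ a b := by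
  unfold lumped totalCoeff
  generalize C.numLoc γ = W at hN
  induction W with
  | zero => exact ⟨isSchur_id, by simp⟩
  | succ W ih =>
    obtain ⟨h1, h2⟩ := ih fun w hw => hN w (hw.trans W.lt_succ_self)
    obtain ⟨h3, h4⟩ := (hN W W.lt_succ_self).comp h1
    rw [List.range_succ, List.foldl_append]
    refine ⟨h3, fun a b => (h4 a b).trans ?_⟩
    rw [h2, Finset.prod_range_succ, mul_comm]

/-- The real part of the coefficient by which the noise on `γ` multiplies the coherences. -/
def dampingFactor (N : C.Noise L) (γ : C.PhysQubit L) : ℝ := 1 - 2 * zWeight (lumped N γ)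

theorem totalCoeff_self {N : C.Noise L} {γ : C.PhysQubit L}
    (hN : ∀ w < C.numLoc γ, IsPureZCoherent (N γ w)) (a : Bit) : totalCoeff N γ a a = 1 :=
  Finset.prod_eq_one fun w hw => (hN w (Finset.mem_range.mp hw)).schurCoeff_self a

theorem totalCoeff_symm {N : C.Noise L} {γ : C.PhysQubit L}
    (hN : ∀ w < C.numLoc γ, IsPureZCoherent (N γ w)) (a b : Bit) :
    totalCoeff N γ b a = star (totalCoeff N γ a b) := by
  rw [totalCoeff, totalCoeff, star_prod]
  exact Finset.prod_congr rfl fun w hw => (hN w (Finset.mem_range.mp hw)).schurCoeff_symm a b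

/-- The two coherence coefficients are conjugate, so their sum is real: the imaginary part, the
coherent part of the noise, drops out of the diagonal weights. -/
theorem chi_totalCoeff_self {N : C.Noise L} {γ : C.PhysQubit L}
    (hN : ∀ w < C.numLoc γ, IsPureZCoherent (N γ w)) (g : Bit) :
    chi (totalCoeff N γ) g g = (1 + sgn g * (totalCoeff N γ 0 1).re) / 2 := by
  rw [chi_self, totalCoeff_self hN, totalCoeff_self hN, totalCoeff_symm hN 0 1, Complex.star_def,
    Complex.add_conj]
  push_cast
  ring

theorem dampingFactor_eq {N : C.Noise L} {γ : C.PhysQubit L}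
    (hN : ∀ w < C.numLoc γ, IsPureZCoherent (N γ w)) :
    dampingFactor N γ = (totalCoeff N γ 0 1).re := by
  obtain ⟨h1, h2⟩ := lumped_isSchur N γ fun w hw => (hN w hw).isSchur
  have h3 : schurCoeff (lumped N γ) = totalCoeff N γ := by
    funext a b
    exact h2 a b
  have h4 : chi (totalCoeff N γ) 1 1 = ((1 - (totalCoeff N γ 0 1).re) / 2 : ℝ) := by
    rw [chi_totalCoeff_self hN, sgn_one]
    push_cast
    ring
  rw [dampingFactor, zWeight_eq h1, h3, h4, Complex.ofReal_re]
  ring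

theorem abs_dampingFactor_le {N : C.Noise L} {γ : C.PhysQubit L}
    (hN : ∀ w < C.numLoc γ, IsPureZCoherent (N γ w)) : |dampingFactor N γ| ≤ 1 := by
  rw [dampingFactor_eq hN]
  refine (Complex.abs_re_le_norm _).trans ?_
  rw [totalCoeff, norm_prod]
  exact Finset.prod_le_one (fun _ _ => norm_nonneg _) fun w hw =>
    (hN w (Finset.mem_range.mp hw)).norm_schurCoeff_le 0 1

theorem flipProb_mem_Icc {N : C.Noise L} {γ : C.PhysQubit L}
    (hN : ∀ w < C.numLoc γ, IsPureZCoherent (N γ w)) (w : ℕ) :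
    flipProb N γ w ∈ Set.Icc (0 : ℝ) 1 := by
  have h := abs_le.mp (abs_splitRoot_le _ (abs_dampingFactor_le hN) (C.numLoc γ) w)
  rw [dampingFactor] at h
  rw [flipProb]
  constructor <;> linarith [h.1, h.2]

/-! ### Phase flips and inserted Pauli gates -/

theorem isSchur_pauliReplacement (N : C.Noise L) (γ : C.PhysQubit L) (w : ℕ) :
    IsSchur (pauliReplacement N γ w) :=
  isSchur_of_forall (phaseFlip_apply _)

theorem totalCoeff_pauliReplacement_eq_prod (N : C.Noise L) (γ : C.PhysQubit L) (a b : Bit) :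
    totalCoeff (pauliReplacement N) γ a b =
      ∏ w ∈ Finset.range (C.numLoc γ),
        (((1 - flipProb N γ w : ℝ) : ℂ) + flipProb N γ w * sgn (a + b)) :=
  Finset.prod_congr rfl fun _ _ => schurCoeff_eq (phaseFlip_apply _) a b

/-- A phase flip multiplies coherences by 1 - 2p, which is the `splitRoot` at its location, and
these multiply to the damping factor. -/
theorem totalCoeff_pauliReplacement_of_ne (N : C.Noise L) (γ : C.PhysQubit L) {a b : Bit}
    (h : a + b = 1) : totalCoeff (pauliReplacement N) γ a b = dampingFactor N γ := by
  rw [totalCoeff_pauliReplacement_eq_prod, h, sgn_one,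
    ← prod_splitRoot (dampingFactor N γ) (numLoc_ne_zero γ), Complex.ofReal_prod]
  refine Finset.prod_congr rfl fun w _ => ?_
  rw [flipProb, ← dampingFactor]
  push_cast
  ring

theorem chi_totalCoeff_pauliReplacement {N : C.Noise L} {γ : C.PhysQubit L}
    (hN : ∀ w < C.numLoc γ, IsPureZCoherent (N γ w)) (g : Bit) :
    chi (totalCoeff (pauliReplacement N) γ) g g = chi (totalCoeff N γ) g g := by
  have h : ∀ a, totalCoeff (pauliReplacement N) γ a a = 1 := by
    intro a
    rw [totalCoeff_pauliReplacement_eq_prod]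
    refine Finset.prod_eq_one fun w _ => ?_
    rw [bit_add_self, sgn_zero]
    push_cast
    ring
  rw [chi_totalCoeff_self hN, ← dampingFactor_eq hN, chi_self, h, h,
    totalCoeff_pauliReplacement_of_ne N γ (zero_add 1),
    totalCoeff_pauliReplacement_of_ne N γ (add_zero 1)]
  ring

theorem isSchur_insertPaulis (e : C.ErrorConfig L) (γ : C.PhysQubit L) (w : ℕ) :
    IsSchur (insertPaulis e γ w) := by
  unfold insertPaulis
  split_ifs
  · exact isSchur_of_forall (conjBy_pauliZ_pow_apply _)
  · exact isSchur_id

/-- The coefficient of the Pauli gates `Z^{e_w}` on a single qubit. -/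
def gateCoeff {W : ℕ} (e : Fin W → Bit) (a b : Bit) : ℂ := ∏ w, sgn (e w * (a + b))

theorem totalCoeff_insertPaulis (e : C.ErrorConfig L) (γ : C.PhysQubit L) :
    totalCoeff (insertPaulis e) γ = gateCoeff (e γ) := by
  funext a b
  rw [totalCoeff, gateCoeff, Finset.prod_range]
  refine Finset.prod_congr rfl fun w _ => ?_
  have h : insertPaulis e γ w = conjBy (pauliZ ^ (e γ w).val) := by
    simp [insertPaulis]
  rw [coeff, h]
  exact schurCoeff_eq (conjBy_pauliZ_pow_apply _) a b

theorem sum_mul_chi {ι : Type*} [Fintype ι] (w : ι → ℂ) (c : ι → Bit → Bit → ℂ) (g g' : Bit) :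
    ∑ j, w j * chi (c j) g g' = chi (fun a b => ∑ j, w j * c j a b) g g' := by
  simp only [chi, sum_bit, Finset.mul_sum, ← Finset.sum_add_distrib, Finset.sum_div]
  refine Finset.sum_congr rfl fun j _ => ?_
  ring

/-- The expected coefficient of random Pauli gates is the coefficient of the Pauli channels. -/
theorem sum_prob_mul_chi (N : C.Noise L) (γ : C.PhysQubit L) (g : Bit) :
    ∑ e : Fin (C.numLoc γ) → Bit,
      (∏ w : Fin (C.numLoc γ), ((if e w = 1 then flipProb N γ w else 1 - flipProb N γ w : ℝ) : ℂ)) *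
        chi (gateCoeff e) g g = chi (totalCoeff (pauliReplacement N) γ) g g := by
  rw [sum_mul_chi]
  congr 1
  funext a b
  rw [totalCoeff_pauliReplacement_eq_prod, Finset.prod_range]
  have h : ∀ w : Fin (C.numLoc γ),
      (((1 - flipProb N γ w : ℝ) : ℂ) + flipProb N γ w * sgn (a + b)) =
        ∑ x : Bit, ((if x = 1 then flipProb N γ w else 1 - flipProb N γ w : ℝ) : ℂ) *
          sgn (x * (a + b)) := by
    intro w
    simp [sum_bit]
  rw [Finset.prod_congr rfl fun w _ => h w, Finset.prod_univ_sum, Fintype.piFinset_univ]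
  simp only [gateCoeff, Finset.prod_mul_distrib]

end CSSCode

end Foliation

end

open Foliation CSSCode in
theorem corollary2 {n k L : ℕ} (C : CSSCode n) (sch : C.Schedule L)
    (V : Matrix (Fin n → Bit) (Fin k → Bit) ℂ) (hV : C.IsEncoder V)
    (R : C.Syndrome L → Op (Fin n) →ₗ[ℂ] Op (Fin k)) (hR : ∀ σ, IsChannel (R σ))
    (N : C.Noise L) (hN : ∀ γ, ∀ w < C.numLoc γ, IsPureZCoherent (N γ w)) :
    (∀ γ, ∀ w < C.numLoc γ, flipProb N γ w ∈ Set.Icc (0 : ℝ) 1 ∧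
      IsPauliChannel (pauliReplacement N γ w)) ∧
    logicalChannel sch V R N = logicalChannel sch V R (pauliReplacement N) ∧
    ∀ ρ, logicalChannel sch V R N ρ =
      ∑ e : C.ErrorConfig L, (configProb N e : ℂ) • logicalChannel sch V R (insertPaulis e) ρ := by
  have hlog := logicalChannel_eq_sum sch hV R N fun γ w hw => (hN γ w hw).isSchur
  refine ⟨fun γ w _ => ?_, funext fun ρ => ?_, fun ρ => ?_⟩
  · have hp := flipProb_mem_Icc (hN γ) w
    exact ⟨hp, isPauliChannel_phaseFlip hp⟩
  · rw [hlog, logicalChannel_eq_sum sch hV R _ fun γ w _ => isSchur_pauliReplacement N γ w]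
    simp only [chi_totalCoeff_pauliReplacement (hN _)]
  · have hins : ∀ e : C.ErrorConfig L, logicalChannel sch V R (insertPaulis e) ρ =
        ∑ E : C.Outcome L, (∏ γ, chi (gateCoeff (e γ)) (errAt E γ) (errAt E γ)) •
          errorTerm V R ρ E := by
      intro e
      rw [logicalChannel_eq_sum sch hV R _ fun γ w _ => isSchur_insertPaulis e γ w]
      simp only [totalCoeff_insertPaulis]
    simp only [hlog, hins, Finset.smul_sum, smul_smul]
    rw [Finset.sum_comm]
    refine Finset.sum_congr rfl fun E _ => ?_
    rw [← Finset.sum_smul]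
    congr 1
    simp only [configProb, Complex.ofReal_prod, ← Finset.prod_mul_distrib,
      ← chi_totalCoeff_pauliReplacement (hN _), ← sum_prob_mul_chi]
    -- Independence of the locations: the product over qubits of the expectations on each qubit is
    -- the sum over all configurations.
    rw [Finset.prod_univ_sum, Fintype.piFinset_univ]
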